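/- Let types be generated by $\sigma ::= p \mid \sigma\supset\sigma \mid \Box\sigma$ ($p$ a type constant) and terms, taken up to $\alpha$-equivalence, by $$M ::= c^{\tau} \mid x \mid \lambda x^{\sigma}.M \mid MM \mid \mathsf{box}\ x_1^{\sigma_1},\dots,x_n^{\sigma_n}\ \mathsf{be}\ M_1,\dots,M_n\ \mathsf{in}\ M \qquad (n\ge 0),$$ where $c$ ranges over constants and $x$ over variables, and the free variables of $\mathsf{box}\ \vec x\ \mathsf{be}\ \vec N\ \mathsf{in}\ M$ are those of $\vec N$. Typing is given by the usual rules of the simply typed $\lambda$-calculus (with $\Gamma\vdash c^\tau:\tau$ for constants) and the rule: if $x_1:\sigma_1,\dots,x_n:\sigma_n\vdash M:\tau$ and $\Gamma\vdash N_i:\Box\sigma_i$ for $i=1,\dots,n$, then $\Gamma\vdash \mathsf{box}\ x_1^{\sigma_1},\dots,x_n^{\sigma_n}\ \mathsf{be}\ N_1,\dots,N_n\ \mathsf{in}\ M:\Box\tau$. Let $\to_{\mathsf n}$ be the closure under all term contexts (including the bodies of $\lambda$ and $\mathsf{box}$) of the rules - $(\beta_\supset)$ $(\lambda x.M)N\to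 M\{x:=N\}$; - $(\eta_\supset)$ $\lambda x.Mx\to M$ if $x$ is not free in $M$; - $(\mathrm{id}_\Box)$ $\mathsf{box}\ x\ \mathsf{be}\ M\ \mathsf{in}\ x\to M$; - $(\beta_\Box)$ $\mathsf{box}\ \vec w,x,\vec z\ \mathsf{be}\ \vec P,(\mathsf{box}\ \vec y\ \mathsf{be}\ \vec L\ \mathsf{in}\ N),\vec Q\ \mathsf{in}\ M\to \mathsf{box}\ \vec w,\vec y,\vec z\ \mathsf{be}\ \vec P,\vec L,\vec Q\ \mathsf{in}\ M\{x:=N\}$ where $|\vec w|=|\vec P|$. Then $\to_{\mathsf n}$ is confluent on typable terms: if $\Gamma\vdash M:\tau$, $M\to_{\mathsf n}^*N_1$ and $M\to_{\mathsf n}^*N_2$, then there is a term $L$ with $N_1\to_{\mathsf n}^*L$ and $N_2\to_{\mathsf n}^*L$. -/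

import Mathlib

namespace LamBox

universe u v

/-- Types over a set `P` of type constants: `σ ::= p | σ ⊃ σ | □σ`. -/
inductive Ty (P : Type u) : Type u
  | base (p : P) : Ty P
  | imp (σ τ : Ty P) : Ty P
  | box (σ : Ty P) : Ty P

/-- Terms of the `λ□`-calculus up to `α`-equivalence, in de Bruijn notation.
* `con c τ` is the constant `c` with its type superscript `τ`;
* `var i` is the variable with index `i`;
* `lam σ M` is `λ x^σ. M`, where index `0` of `M` is `x`;
* `box [(σ₁, N₁), …, (σₙ, Nₙ)] M` is `box x₁^σ₁, …, xₙ^σₙ be N₁, …, Nₙ in M`. Its body `M` is a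
  scope of its own: index `i` of `M`, for `i < n`, is the variable `x_{i+1}`, and the variables of
  the context of the whole term are not visible in `M`. -/
inductive Tm (P : Type u) (C : Type v) : Type (max u v)
  | con (c : C) (τ : Ty P) : Tm P C
  | var (i : ℕ) : Tm P C
  | lam (σ : Ty P) (M : Tm P C) : Tm P C
  | app (M N : Tm P C) : Tm P C
  | box (B : List (Ty P × Tm P C)) (M : Tm P C) : Tm P C

variable {P : Type u} {C : Type v}

/-- Extension of a renaming of variables under one binder. -/
def upRen (ρ : ℕ → ℕ) : ℕ → ℕ
  | 0 => 0
  | i + 1 => ρ i + 1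

mutual

/-- Renaming of the free variables of a term. The free variables of a boxed term are those of its
arguments, so the body of a box is left alone. -/
def Tm.rename : Tm P C → (ℕ → ℕ) → Tm P C
  | .con c τ, _ => .con c τ
  | .var i, ρ => .var (ρ i)
  | .lam σ M, ρ => .lam σ (M.rename (upRen ρ))
  | .app M N, ρ => .app (M.rename ρ) (N.rename ρ)
  | .box B M, ρ => .box (renameArgs B ρ) M

/-- Renaming in each argument of a box. -/
def renameArgs : List (Ty P × Tm P C) → (ℕ → ℕ) → List (Ty P × Tm P C)
  | [], _ => []
  | b :: B, ρ => renameArg b ρ :: renameArgs B ρ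

/-- Renaming in one argument of a box. -/
def renameArg : Ty P × Tm P C → (ℕ → ℕ) → Ty P × Tm P C
  | (σ, N), ρ => (σ, N.rename ρ)

end

/-- Extension of a simultaneous substitution under one binder. -/
def upSubst (s : ℕ → Tm P C) : ℕ → Tm P C
  | 0 => .var 0
  | i + 1 => (s i).rename Nat.succ

mutual

/-- Simultaneous capture-avoiding substitution for the free variables of a term. -/
def Tm.subst : Tm P C → (ℕ → Tm P C) → Tm P C
  | .con c τ, _ => .con c τ
  | .var i, s => s i
  | .lam σ M, s => .lam σ (M.subst (upSubst s))
  | .app M N, s => .app (M.subst s) (N.subst s)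
  | .box B M, s => .box (substArgs B s) M

/-- Substitution in each argument of a box. -/
def substArgs : List (Ty P × Tm P C) → (ℕ → Tm P C) → List (Ty P × Tm P C)
  | [], _ => []
  | b :: B, s => substArg b s :: substArgs B s

/-- Substitution in one argument of a box. -/
def substArg : Ty P × Tm P C → (ℕ → Tm P C) → Ty P × Tm P C
  | (σ, N), s => (σ, N.subst s)

end

/-- The substitution `{x := N}` for the variable with index `0`, which disappears. -/
def single (N : Tm P C) : ℕ → Tm P C
  | 0 => N
  | i + 1 => .var i

/-- The substitution `{x := N}` on terms with variables `w, x, z` (with `|w| = a`), where the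
variables of `N` are `y` (with `|y| = l`); the result has the variables `w, y, z`. -/
def splice (a l : ℕ) (N : Tm P C) (i : ℕ) : Tm P C :=
  if i < a then .var i
  else if i = a then N.rename (fun j => a + j)
  else .var (i - 1 + l)

/-- The typing judgement `Γ ⊢ M : τ`; the entry of `Γ` at position `i` is the type of the variable
with index `i`. -/
inductive Typing : List (Ty P) → Tm P C → Ty P → Prop
  | con (Γ : List (Ty P)) (c : C) (τ : Ty P) : Typing Γ (.con c τ) τ
  | var (Γ : List (Ty P)) (i : ℕ) (τ : Ty P) (h : Γ[i]? = some τ) : Typing Γ (.var i) τ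
  | lam (Γ : List (Ty P)) (σ τ : Ty P) (M : Tm P C) (hM : Typing (σ :: Γ) M τ) :
      Typing Γ (.lam σ M) (.imp σ τ)
  | app (Γ : List (Ty P)) (σ τ : Ty P) (M N : Tm P C) (hM : Typing Γ M (.imp σ τ))
      (hN : Typing Γ N σ) : Typing Γ (.app M N) τ
  | box (Γ : List (Ty P)) (τ : Ty P) (B : List (Ty P × Tm P C)) (M : Tm P C)
      (hM : Typing (B.map Prod.fst) M τ) (hB : ∀ b ∈ B, Typing Γ b.2 (.box b.1)) :
      Typing Γ (.box B M) (.box τ)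

/-- Labels of the call-by-name reduction rules: `β⊃`, `η⊃`, `id□`, `β□`. -/
inductive Label : Type
  | betaImp
  | etaImp
  | idBox
  | betaBox

/-- The call-by-name reduction rules at the root of a term. -/
inductive Rule : Label → Tm P C → Tm P C → Prop
  /-- `(λx.M) N → M{x := N}` -/
  | betaImp (σ : Ty P) (M N : Tm P C) :
      Rule .betaImp (.app (.lam σ M) N) (M.subst (single N))
  /-- `λx.M x → M` for `x` not free in `M` -/
  | etaImp (σ : Ty P) (M : Tm P C) :
      Rule .etaImp (.lam σ (.app (M.rename Nat.succ) (.var 0))) M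
  /-- `box x be M in x → M` -/
  | idBox (σ : Ty P) (M : Tm P C) :
      Rule .idBox (.box [(σ, M)] (.var 0)) M
  /-- `box w, x, z be W, (box y be L in N), Q in M → box w, y, z be W, L, Q in M{x := N}` -/
  | betaBox (W L Q : List (Ty P × Tm P C)) (σ : Ty P) (M N : Tm P C) :
      Rule .betaBox (.box (W ++ (σ, .box L N) :: Q) M)
        (.box (W ++ L ++ Q) (M.subst (splice W.length L.length N)))

/-- The one-step reduction `→_X` for a set `X` of labels: one application of a rule whose label is
in `X`, anywhere in a term. -/
inductive Step (X : Set Label) : Tm P C → Tm P C → Prop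
  | rule (l : Label) (hl : l ∈ X) (M N : Tm P C) (h : Rule l M N) : Step X M N
  | lam (σ : Ty P) (M M' : Tm P C) (h : Step X M M') : Step X (.lam σ M) (.lam σ M')
  | appLeft (M M' N : Tm P C) (h : Step X M M') : Step X (.app M N) (.app M' N)
  | appRight (M N N' : Tm P C) (h : Step X N N') : Step X (.app M N) (.app M N')
  | boxArg (B₁ B₂ : List (Ty P × Tm P C)) (σ : Ty P) (N N' M : Tm P C) (h : Step X N N') :
      Step X (.box (B₁ ++ (σ, N) :: B₂) M) (.box (B₁ ++ (σ, N') :: B₂) M)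
  | boxBody (B : List (Ty P × Tm P C)) (M M' : Tm P C) (h : Step X M M') :
      Step X (.box B M) (.box B M')

/-- The set `n = {β⊃, η⊃, id□, β□}` of the labels of the call-by-name calculus. -/
def cbn : Set Label := {.betaImp, .etaImp, .idBox, .betaBox}

end LamBox

namespace LamBox

universe u v

variable {P : Type u} {C : Type v}

open Relation

-- The rules are split into `beta` (`β⊃`, `β□`) and `etaId` (`η⊃`, `id□`). On typable terms each
-- half is confluent and the two halves commute, so their union is confluent by the Hindley–Rosen
-- argument (`cbn_confluent`).
--
-- For `beta`, the map `Tm.dev` has the Z-property (`Step.dev`): if `M` reduces to `N` in one step,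
-- then `N` reduces to `M.dev` and `M.dev` to `N.dev`. Confluence follows (`beta_confluent`).
-- `Tm.dev` looks for a redex only after the parts are developed, so it also contracts some redexes
-- created on the way. The two rules rest on `dev_subst_steps` (development against substitution)
-- and `contractBox_nested` (flattening nested boxes does not depend on the order). Types play no
-- role here, but scoping does: if a box body had variables other than those bound by its box,
-- contractions in two arguments of one box would not commute.
--
-- The rules of `etaId` copy nothing. Hence a step of any kind and an `etaId`-step from the same
-- typable term are joined by several `etaId`-steps on one side and at most one step of the given
-- kind on the other (`Step.commute`). Taking `beta` as the kind gives commutation, taking `etaId`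
-- gives confluence of `etaId`. Typing is essential: `λx^σ.(λy^ρ.M)x` contracts by `β⊃` to
-- `λx^σ.M{y:=x}` and by `η⊃` to `λy^ρ.M`, which are equal only if `σ = ρ`. The overlap of `id□`
-- with `β□` is similar. Subject reduction (`Step.typing`) makes typability an invariant.

-- Algebra of renaming and substitution.

/-- Structural induction on terms, with an induction hypothesis for every argument of a box. -/
theorem Tm.ind {motive : Tm P C → Prop} (con : ∀ c τ, motive (.con c τ))
    (var : ∀ i, motive (.var i)) (lam : ∀ σ M, motive M → motive (.lam σ M))
    (app : ∀ M N, motive M → motive N → motive (.app M N))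
    (box : ∀ B M, (∀ b ∈ B, motive b.2) → motive M → motive (.box B M)) (M : Tm P C) :
    motive M :=
  Tm.rec (motive_1 := motive) (motive_2 := fun B => ∀ b ∈ B, motive b.2)
    (motive_3 := fun b => motive b.2) con var lam app box (by simp)
    (fun b B hb hB c hc => by
      rcases List.mem_cons.1 hc with rfl | h
      exacts [hb, hB c h])
    (fun _ _ h => h) M

theorem renameArgs_eq_map (B : List (Ty P × Tm P C)) (ρ : ℕ → ℕ) :
    renameArgs B ρ = B.map fun b => (b.1, b.2.rename ρ) := by
  induction B with
  | nil => rfl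
  | cons b B ih =>
    obtain ⟨σ, N⟩ := b
    simp [renameArgs, renameArg, ih]

theorem substArgs_eq_map (B : List (Ty P × Tm P C)) (s : ℕ → Tm P C) :
    substArgs B s = B.map fun b => (b.1, b.2.subst s) := by
  induction B with
  | nil => rfl
  | cons b B ih =>
    obtain ⟨σ, N⟩ := b
    simp [substArgs, substArg, ih]

@[simp] theorem rename_con (c : C) (τ : Ty P) (ρ : ℕ → ℕ) :
    (Tm.con c τ).rename ρ = .con c τ := by simp [Tm.rename]

@[simp] theorem rename_var (i : ℕ) (ρ : ℕ → ℕ) :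
    (Tm.var i : Tm P C).rename ρ = .var (ρ i) := by simp [Tm.rename]

@[simp] theorem rename_lam (σ : Ty P) (M : Tm P C) (ρ : ℕ → ℕ) :
    (Tm.lam σ M).rename ρ = .lam σ (M.rename (upRen ρ)) := by simp [Tm.rename]

@[simp] theorem rename_app (M N : Tm P C) (ρ : ℕ → ℕ) :
    (Tm.app M N).rename ρ = .app (M.rename ρ) (N.rename ρ) := by simp [Tm.rename]

@[simp] theorem rename_box (B : List (Ty P × Tm P C)) (M : Tm P C) (ρ : ℕ → ℕ) :
    (Tm.box B M).rename ρ = .box (B.map fun b => (b.1, b.2.rename ρ)) M := by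
  simp [Tm.rename, renameArgs_eq_map]

@[simp] theorem subst_con (c : C) (τ : Ty P) (s : ℕ → Tm P C) :
    (Tm.con c τ).subst s = .con c τ := by simp [Tm.subst]

@[simp] theorem subst_var (i : ℕ) (s : ℕ → Tm P C) :
    (Tm.var i : Tm P C).subst s = s i := by simp [Tm.subst]

@[simp] theorem subst_lam (σ : Ty P) (M : Tm P C) (s : ℕ → Tm P C) :
    (Tm.lam σ M).subst s = .lam σ (M.subst (upSubst s)) := by simp [Tm.subst]

@[simp] theorem subst_app (M N : Tm P C) (s : ℕ → Tm P C) :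
    (Tm.app M N).subst s = .app (M.subst s) (N.subst s) := by simp [Tm.subst]

@[simp] theorem subst_box (B : List (Ty P × Tm P C)) (M : Tm P C) (s : ℕ → Tm P C) :
    (Tm.box B M).subst s = .box (B.map fun b => (b.1, b.2.subst s)) M := by
  simp [Tm.subst, substArgs_eq_map]

@[simp] theorem upRen_zero (ρ : ℕ → ℕ) : upRen ρ 0 = 0 := rfl

@[simp] theorem upRen_succ (ρ : ℕ → ℕ) (i : ℕ) : upRen ρ (i + 1) = ρ i + 1 := rfl

@[simp] theorem upSubst_zero (s : ℕ → Tm P C) : upSubst s 0 = .var 0 := rfl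

@[simp] theorem upSubst_succ (s : ℕ → Tm P C) (i : ℕ) :
    upSubst s (i + 1) = (s i).rename Nat.succ := rfl

@[simp] theorem single_zero (N : Tm P C) : single N 0 = N := rfl

@[simp] theorem single_succ (N : Tm P C) (i : ℕ) : single N (i + 1) = .var i := rfl

theorem rename_eq_subst (M : Tm P C) (ρ : ℕ → ℕ) : M.rename ρ = M.subst fun i => .var (ρ i) := by
  induction M using Tm.ind generalizing ρ with
  | con | var => simp
  | lam σ M ih =>
    simp only [rename_lam, subst_lam, ih]
    congr 2
    funext i
    cases i <;> simp
  | app M N ihM ihN => simp [ihM, ihN]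
  | box B M ihB _ =>
    simp only [rename_box, subst_box]
    congr 1
    exact List.map_congr_left fun b hb => by rw [ihB b hb]

theorem subst_id (M : Tm P C) : M.subst Tm.var = M := by
  induction M using Tm.ind with
  | con | var => simp
  | lam σ M ih =>
    have : upSubst (Tm.var : ℕ → Tm P C) = Tm.var := by
      funext i
      cases i <;> simp
    simp [this, ih]
  | app M N ihM ihN => simp [ihM, ihN]
  | box B M ihB _ =>
    simp only [subst_box]
    congr 1
    exact (List.map_congr_left fun b hb => by rw [ihB b hb, id]).trans (List.map_id B)

theorem subst_eq_self {M : Tm P C} {s : ℕ → Tm P C} (h : ∀ i, s i = .var i) : M.subst s = M := by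
  rw [funext h, subst_id]

theorem rename_rename (M : Tm P C) (ρ ρ' : ℕ → ℕ) :
    (M.rename ρ).rename ρ' = M.rename fun i => ρ' (ρ i) := by
  induction M using Tm.ind generalizing ρ ρ' with
  | con | var => simp
  | lam σ M ih =>
    simp only [rename_lam, ih]
    congr 2
    funext i
    cases i <;> simp
  | app M N ihM ihN => simp [ihM, ihN]
  | box B M ihB _ =>
    simp only [rename_box, List.map_map]
    congr 1
    exact List.map_congr_left fun b hb => by simp [ihB b hb]

theorem rename_subst (M : Tm P C) (ρ : ℕ → ℕ) (s : ℕ → Tm P C) :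
    (M.rename ρ).subst s = M.subst fun i => s (ρ i) := by
  induction M using Tm.ind generalizing ρ s with
  | con | var => simp
  | lam σ M ih =>
    simp only [rename_lam, subst_lam, ih]
    congr 2
    funext i
    cases i <;> simp
  | app M N ihM ihN => simp [ihM, ihN]
  | box B M ihB _ =>
    simp only [rename_box, subst_box, List.map_map]
    congr 1
    exact List.map_congr_left fun b hb => by simp [ihB b hb]

theorem subst_rename (M : Tm P C) (s : ℕ → Tm P C) (ρ : ℕ → ℕ) :
    (M.subst s).rename ρ = M.subst fun i => (s i).rename ρ := by
  induction M using Tm.ind generalizing s ρ with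
  | con | var => simp
  | lam σ M ih =>
    simp only [rename_lam, subst_lam, ih]
    congr 2
    funext i
    cases i <;> simp [rename_rename]
  | app M N ihM ihN => simp [ihM, ihN]
  | box B M ihB _ =>
    simp only [rename_box, subst_box, List.map_map]
    congr 1
    exact List.map_congr_left fun b hb => by simp [ihB b hb]

theorem subst_subst (M : Tm P C) (s t : ℕ → Tm P C) :
    (M.subst s).subst t = M.subst fun i => (s i).subst t := by
  induction M using Tm.ind generalizing s t with
  | con | var => simp
  | lam σ M ih =>
    simp only [subst_lam, ih]
    congr 2
    funext i
    cases i <;> simp [rename_subst, subst_rename]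
  | app M N ihM ihN => simp [ihM, ihN]
  | box B M ihB _ =>
    simp only [subst_box, List.map_map]
    congr 1
    exact List.map_congr_left fun b hb => by simp [ihB b hb]

theorem subst_single_subst (M N : Tm P C) (s : ℕ → Tm P C) :
    (M.subst (single N)).subst s = (M.subst (upSubst s)).subst (single (N.subst s)) := by
  rw [subst_subst, subst_subst]
  congr 1
  funext i
  cases i with
  | zero => simp
  | succ i => simp [rename_subst, subst_id]

theorem rename_single_rename (M N : Tm P C) (ρ : ℕ → ℕ) :
    (M.subst (single N)).rename ρ = (M.rename (upRen ρ)).subst (single (N.rename ρ)) := by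
  rw [subst_rename, rename_subst]
  congr 1
  funext i
  cases i <;> simp

theorem rename_succ_subst_upSubst (M : Tm P C) (s : ℕ → Tm P C) :
    (M.rename Nat.succ).subst (upSubst s) = (M.subst s).rename Nat.succ := by
  rw [rename_subst, subst_rename]
  rfl

theorem rename_succ_subst_single (M N : Tm P C) :
    (M.rename Nat.succ).subst (single N) = M := by
  rw [rename_subst]
  exact subst_eq_self fun i => rfl

theorem rename_succ_injective {M N : Tm P C} (h : M.rename Nat.succ = N.rename Nat.succ) :
    M = N := by
  rw [← rename_succ_subst_single M M, h, rename_succ_subst_single]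

-- Scoping, and the commutation laws of splicing.

/-- All variables of the term are in scope, when the free ones are to have indices below `n`. -/
inductive Scoped : ℕ → Tm P C → Prop
  | con (n : ℕ) (c : C) (τ : Ty P) : Scoped n (.con c τ)
  | var (n i : ℕ) (h : i < n) : Scoped n (.var i)
  | lam (n : ℕ) (σ : Ty P) (M : Tm P C) (hM : Scoped (n + 1) M) : Scoped n (.lam σ M)
  | app (n : ℕ) (M N : Tm P C) (hM : Scoped n M) (hN : Scoped n N) : Scoped n (.app M N)
  | box (n : ℕ) (B : List (Ty P × Tm P C)) (M : Tm P C) (hM : Scoped B.length M)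
      (hB : ∀ b ∈ B, Scoped n b.2) : Scoped n (.box B M)

theorem Scoped.subst_congr {n : ℕ} {M : Tm P C} (hM : Scoped n M) {s t : ℕ → Tm P C}
    (h : ∀ i < n, s i = t i) : M.subst s = M.subst t := by
  induction hM generalizing s t with
  | con => simp
  | var n i hi => simpa using h i hi
  | lam n σ M _ ih =>
    simp only [subst_lam]
    congr 1
    refine ih fun i hi => ?_
    cases i with
    | zero => rfl
    | succ i => simp [h i (by omega)]
  | app n M N _ _ ihM ihN => simp [ihM h, ihN h]
  | box n B M _ _ _ ihB =>
    simp only [subst_box]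
    congr 1
    exact List.map_congr_left fun b hb => by rw [ihB b hb h]

theorem Scoped.rename {n m : ℕ} {M : Tm P C} (hM : Scoped n M) {ρ : ℕ → ℕ}
    (h : ∀ i < n, ρ i < m) : Scoped m (M.rename ρ) := by
  induction hM generalizing m ρ with
  | con n c τ => simpa using Scoped.con m c τ
  | var n i hi => simpa using Scoped.var m _ (h i hi)
  | lam n σ M _ ih =>
    rw [rename_lam]
    refine .lam _ _ _ (ih fun i hi => ?_)
    cases i with
    | zero => simp
    | succ i => simpa using h i (by omega)
  | app n M N _ _ ihM ihN =>
    rw [rename_app]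
    exact .app _ _ _ (ihM h) (ihN h)
  | box n B M hM _ _ ihB =>
    rw [rename_box]
    refine .box _ _ _ (by simpa using hM) fun b hb => ?_
    obtain ⟨b, hb', rfl⟩ := List.mem_map.1 hb
    exact ihB b hb' h

theorem Scoped.subst {n m : ℕ} {M : Tm P C} (hM : Scoped n M) {s : ℕ → Tm P C}
    (h : ∀ i < n, Scoped m (s i)) : Scoped m (M.subst s) := by
  induction hM generalizing m s with
  | con n c τ => simpa using Scoped.con m c τ
  | var n i hi => simpa using h i hi
  | lam n σ M _ ih =>
    rw [subst_lam]
    refine .lam _ _ _ (ih fun i hi => ?_)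
    cases i with
    | zero => exact .var _ _ (by omega)
    | succ i => exact (h i (by omega)).rename fun j hj => by omega
  | app n M N _ _ ihM ihN =>
    rw [subst_app]
    exact .app _ _ _ (ihM h) (ihN h)
  | box n B M hM _ _ ihB =>
    rw [subst_box]
    refine .box _ _ _ (by simpa using hM) fun b hb => ?_
    obtain ⟨b, hb', rfl⟩ := List.mem_map.1 hb
    exact ihB b hb' h

theorem scoped_splice {a l q : ℕ} {N : Tm P C} (hN : Scoped l N) :
    ∀ i < a + 1 + q, Scoped (a + l + q) (splice a l N i) := by
  intro i hi
  unfold splice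
  split_ifs with h h'
  · exact .var _ _ (by omega)
  · exact hN.rename fun j hj => by omega
  · exact .var _ _ (by omega)

/-- Splicing at two different positions commutes. -/
theorem splice_comm (a b l l' : ℕ) (M : Tm P C) {N : Tm P C} (N' : Tm P C) (hN : Scoped l N) :
    (M.subst (splice (a + 1 + b) l' N')).subst (splice a l N) =
      (M.subst (splice a l N)).subst (splice (a + l + b) l' N') := by
  rw [subst_subst, subst_subst]
  congr 1
  funext i
  rcases lt_trichotomy i a with h | rfl | h
  · simp [splice, h, show i < a + 1 + b by omega, show i < a + l + b by omega]
  · simp only [splice, show i < i + 1 + b by omega, lt_irrefl, if_true, if_false, subst_var,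
      rename_subst]
    rw [rename_eq_subst]
    -- The only use of scoping: the variables of `N` land in the block of length `l` starting at the
    -- splice point, which the second splice fixes. A variable beyond `l` could be moved by it.
    exact hN.subst_congr fun j hj => by simp [show i + j < i + l + b by omega]
  · rcases lt_trichotomy i (a + 1 + b) with h' | rfl | h'
    · simp [splice, h', show ¬ i < a by omega, show i ≠ a by omega,
        show i - 1 + l < a + l + b by omega]
    · simp only [splice, lt_irrefl, if_true, if_false, subst_var, show ¬ a + 1 + b < a by omega,
        show a + 1 + b ≠ a by omega,
        show a + 1 + b - 1 + l = a + l + b by omega, rename_subst]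
      rw [rename_eq_subst N']
      congr 1
      funext j
      simp only [if_neg (show ¬ a + 1 + b + j < a by omega),
        if_neg (show a + 1 + b + j ≠ a by omega)]
      congr 1
      omega
    · simp [splice, show ¬ i < a + 1 + b by omega, show ¬ i < a by omega, show i ≠ a by omega,
        show i ≠ a + 1 + b by omega, show ¬ i - 1 + l < a + l + b by omega,
        show i - 1 + l ≠ a + l + b by omega, show ¬ i - 1 + l' < a by omega,
        show i - 1 + l' ≠ a by omega]
      omega

/-- Splicing into a spliced term. -/
theorem splice_splice (a k l m : ℕ) (M N R : Tm P C) :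
    (M.subst (splice a (k + 1 + m) N)).subst (splice (a + k) l R) =
      M.subst (splice a (k + l + m) (N.subst (splice k l R))) := by
  rw [subst_subst]
  congr 1
  funext i
  rcases lt_trichotomy i a with h | rfl | h
  · simp [splice, h, show i < a + k by omega]
  · simp only [splice, lt_irrefl, if_true, if_false, rename_subst, subst_rename]
    congr 1
    funext j
    rcases lt_trichotomy j k with h | rfl | h
    · simp [h]
    · simp [rename_rename, add_assoc]
    · simp [show ¬ j < k by omega, show j ≠ k by omega]
      omega
  · simp [splice, show ¬ i < a by omega, show i ≠ a by omega,
      show ¬ i - 1 + (k + 1 + m) < a + k by omega, show i - 1 + (k + 1 + m) ≠ a + k by omega]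
    omega

-- Closure of reduction under substitution and contexts.

theorem Rule.subst {l : Label} {M N : Tm P C} (h : Rule l M N) (s : ℕ → Tm P C) :
    Rule l (M.subst s) (N.subst s) := by
  cases h with
  | betaImp σ M N =>
    rw [subst_single_subst]
    simpa using Rule.betaImp σ (M.subst (upSubst s)) (N.subst s)
  | etaImp σ M =>
    simpa [rename_succ_subst_upSubst] using Rule.etaImp σ (N.subst s)
  | idBox σ M => simpa using Rule.idBox σ (N.subst s)
  | betaBox W L Q σ M N =>
    simpa using Rule.betaBox (W.map fun b => (b.1, b.2.subst s))
      (L.map fun b => (b.1, b.2.subst s)) (Q.map fun b => (b.1, b.2.subst s)) σ M N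

theorem Step.subst {X : Set Label} {M N : Tm P C} (h : Step X M N) (s : ℕ → Tm P C) :
    Step X (M.subst s) (N.subst s) := by
  induction h generalizing s with
  | rule l hl M N h => exact .rule l hl _ _ (h.subst s)
  | lam σ M M' _ ih => simpa using Step.lam σ _ _ (ih _)
  | appLeft M M' N _ ih => simpa using Step.appLeft _ _ _ (ih s)
  | appRight M N N' _ ih => simpa using Step.appRight _ _ _ (ih s)
  | boxArg B₁ B₂ σ N N' M _ ih => simpa using Step.boxArg _ _ σ _ _ M (ih s)
  | boxBody B M M' h _ => simpa using Step.boxBody _ _ _ h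

theorem Step.rename {X : Set Label} {M N : Tm P C} (h : Step X M N) (ρ : ℕ → ℕ) :
    Step X (M.rename ρ) (N.rename ρ) := by
  simpa only [rename_eq_subst] using h.subst _

theorem Step.mono {X Y : Set Label} (hXY : X ⊆ Y) {M N : Tm P C} (h : Step X M N) :
    Step Y M N := by
  induction h with
  | rule l hl M N h => exact .rule l (hXY hl) _ _ h
  | lam σ M M' _ ih => exact .lam _ _ _ ih
  | appLeft M M' N _ ih => exact .appLeft _ _ _ ih
  | appRight M N N' _ ih => exact .appRight _ _ _ ih
  | boxArg B₁ B₂ σ N N' M _ ih => exact .boxArg _ _ _ _ _ _ ih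
  | boxBody B M M' h ih => exact .boxBody _ _ _ ih

/-- Many-step reduction. -/
abbrev Steps (X : Set Label) : Tm P C → Tm P C → Prop := ReflTransGen (Step X)

variable {X : Set Label}

theorem Steps.mono {X Y : Set Label} (hXY : X ⊆ Y) {M N : Tm P C} (h : Steps X M N) :
    Steps Y M N :=
  h.lift id fun _ _ h => h.mono hXY

theorem Steps.subst {M N : Tm P C} (h : Steps X M N) (s : ℕ → Tm P C) :
    Steps X (M.subst s) (N.subst s) :=
  h.lift (fun M => M.subst s) fun _ _ h => h.subst s

theorem Steps.rename {M N : Tm P C} (h : Steps X M N) (ρ : ℕ → ℕ) :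
    Steps X (M.rename ρ) (N.rename ρ) :=
  h.lift (fun M => M.rename ρ) fun _ _ h => h.rename ρ

theorem Steps.lam (σ : Ty P) {M N : Tm P C} (h : Steps X M N) :
    Steps X (.lam σ M) (.lam σ N) :=
  h.lift (Tm.lam σ) fun _ _ h => .lam _ _ _ h

theorem Steps.app {M M' N N' : Tm P C} (hM : Steps X M M') (hN : Steps X N N') :
    Steps X (.app M N) (.app M' N') :=
  (hM.lift (fun M => Tm.app M N) fun _ _ h => .appLeft _ _ _ h).trans
    (hN.lift (fun N => Tm.app M' N) fun _ _ h => .appRight _ _ _ h)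

theorem Steps.boxArg (B₁ B₂ : List (Ty P × Tm P C)) (σ : Ty P) {N N' : Tm P C} (M : Tm P C)
    (h : Steps X N N') :
    Steps X (.box (B₁ ++ (σ, N) :: B₂) M) (.box (B₁ ++ (σ, N') :: B₂) M) :=
  h.lift (fun N => Tm.box (B₁ ++ (σ, N) :: B₂) M) fun _ _ h => .boxArg _ _ _ _ _ _ h

theorem Steps.boxBody (B : List (Ty P × Tm P C)) {M M' : Tm P C} (h : Steps X M M') :
    Steps X (.box B M) (.box B M') :=
  h.lift (Tm.box B) fun _ _ h => .boxBody _ _ _ h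

theorem Steps.box_map (f g : Tm P C → Tm P C) (B : List (Ty P × Tm P C)) (M : Tm P C)
    (h : ∀ b ∈ B, Steps X (f b.2) (g b.2)) :
    Steps X (.box (B.map fun b => (b.1, f b.2)) M) (.box (B.map fun b => (b.1, g b.2)) M) := by
  suffices ∀ W : List (Ty P × Tm P C), Steps X (.box (W ++ B.map fun b => (b.1, f b.2)) M)
      (.box (W ++ B.map fun b => (b.1, g b.2)) M) from this []
  induction B with
  | nil => exact fun W => .refl
  | cons b B ih =>
    intro W
    refine (Steps.boxArg W _ b.1 M (h b (by simp))).trans ?_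
    simpa using ih (fun c hc => h c (by simp [hc])) (W ++ [(b.1, g b.2)])

theorem Steps.subst_right (M : Tm P C) {s t : ℕ → Tm P C} (h : ∀ i, Steps X (s i) (t i)) :
    Steps X (M.subst s) (M.subst t) := by
  induction M using Tm.ind generalizing s t with
  | con c τ => simpa using .refl
  | var i => simpa using h i
  | lam σ M ih =>
    rw [subst_lam, subst_lam]
    refine Steps.lam σ (ih fun i => ?_)
    cases i with
    | zero => exact .refl
    | succ i => exact (h i).rename _
  | app M N ihM ihN =>
    rw [subst_app, subst_app]
    exact Steps.app (ihM h) (ihN h)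
  | box B M ihB _ =>
    rw [subst_box, subst_box]
    exact Steps.box_map (fun M => M.subst s) (fun M => M.subst t) B M fun b hb => ihB b hb h

theorem Steps.subst_splice (a l : ℕ) (M : Tm P C) {N N' : Tm P C} (h : Steps X N N') :
    Steps X (M.subst (splice a l N)) (M.subst (splice a l N')) := by
  refine Steps.subst_right M fun i => ?_
  unfold splice
  split_ifs
  exacts [.refl, h.rename _, .refl]

theorem Steps.subst_single (M : Tm P C) {N N' : Tm P C} (h : Steps X N N') :
    Steps X (M.subst (single N)) (M.subst (single N')) := by
  refine Steps.subst_right M fun i => ?_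
  cases i
  exacts [h, .refl]

-- Inversion and scoping for `β`-reduction.

/-- The labels of the `β`-rules. -/
def beta : Set Label := {.betaImp, .betaBox}

theorem Step.beta_imp (σ : Ty P) (M N : Tm P C) :
    Step beta (.app (.lam σ M) N) (M.subst (single N)) :=
  .rule .betaImp (by simp [beta]) _ _ (.betaImp _ _ _)

theorem Step.beta_box (W L Q : List (Ty P × Tm P C)) (σ : Ty P) (M N : Tm P C) :
    Step beta (.box (W ++ (σ, .box L N) :: Q) M)
      (.box (W ++ L ++ Q) (M.subst (splice W.length L.length N))) :=
  .rule .betaBox (by simp [beta]) _ _ (.betaBox _ _ _ _ _ _)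

/-- True because `η⊃` is excluded: no `β`-rule applies at the root of an abstraction. Hence a
`β⊃`-redex stays one while its two parts reduce. -/
theorem Step.lam_inv {σ : Ty P} {M N : Tm P C} (h : Step beta (.lam σ M) N) :
    ∃ M', N = .lam σ M' ∧ Step beta M M' := by
  cases h with
  | rule l hl _ _ h =>
    cases h
    simp [beta] at hl
  | lam _ _ M' h => exact ⟨M', rfl, h⟩

theorem Steps.lam_inv {σ : Ty P} {M N : Tm P C} (h : Steps beta (.lam σ M) N) :
    ∃ M', N = .lam σ M' ∧ Steps beta M M' := by
  induction h with
  | refl => exact ⟨M, rfl, .refl⟩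
  | tail _ h ih =>
    obtain ⟨M', rfl, hM⟩ := ih
    obtain ⟨M'', rfl, hM'⟩ := h.lam_inv
    exact ⟨M'', rfl, hM.tail hM'⟩

/-- A `β`-step from a boxed term leads to a boxed term, and the two can be spliced at the same
place. -/
theorem Step.box_inv {L : List (Ty P × Tm P C)} {N K : Tm P C} (h : Step beta (.box L N) K) :
    ∃ L' N', K = .box L' N' ∧ ∀ W Q : List (Ty P × Tm P C), ∀ M : Tm P C,
      Steps beta (.box (W ++ L ++ Q) (M.subst (splice W.length L.length N)))
        (.box (W ++ L' ++ Q) (M.subst (splice W.length L'.length N'))) := by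
  cases h with
  | rule l hl _ _ h =>
    cases h with
    | idBox => simp [beta] at hl
    | betaBox V J R σ _ D =>
      refine ⟨_, _, rfl, fun W Q M => ReflTransGen.single ?_⟩
      -- After the outer contraction the inner redex is an argument of the outer box, at position
      -- `(W ++ V).length`. By `splice_splice`, contracting it there has the same effect as
      -- contracting it first.
      have := Step.beta_box (W ++ V) J (R ++ Q) σ
        (M.subst (splice W.length (V.length + 1 + R.length) N)) D
      rw [List.length_append, splice_splice] at this
      simpa [add_assoc, add_comm, add_left_comm] using this
  | boxArg B₁ B₂ σ D D' _ h =>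
    refine ⟨_, _, rfl, fun W Q M => ReflTransGen.single ?_⟩
    simpa using Step.boxArg (W ++ B₁) (B₂ ++ Q) σ D D'
      (M.subst (splice W.length (B₁.length + (B₂.length + 1)) N)) h
  | boxBody _ _ N' h =>
    exact ⟨_, _, rfl, fun W Q M => Steps.boxBody _ (Steps.subst_splice _ _ _ (ReflTransGen.single h))⟩

theorem Steps.box_inv {L : List (Ty P × Tm P C)} {N K : Tm P C} (h : Steps beta (.box L N) K) :
    ∃ L' N', K = .box L' N' ∧ ∀ W Q : List (Ty P × Tm P C), ∀ M : Tm P C,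
      Steps beta (.box (W ++ L ++ Q) (M.subst (splice W.length L.length N)))
        (.box (W ++ L' ++ Q) (M.subst (splice W.length L'.length N'))) := by
  induction h with
  | refl => exact ⟨L, N, rfl, fun _ _ _ => .refl⟩
  | tail _ h ih =>
    obtain ⟨L', N', rfl, hL⟩ := ih
    obtain ⟨L'', N'', rfl, hL'⟩ := h.box_inv
    exact ⟨L'', N'', rfl, fun W Q M => (hL W Q M).trans (hL' W Q M)⟩

theorem Step.scoped {M N : Tm P C} (h : Step beta M N) {n : ℕ} (hM : Scoped n M) :
    Scoped n N := by
  induction h generalizing n with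
  | rule l hl M N h =>
    cases h with
    | betaImp σ M N =>
      cases hM with
      | app _ _ _ hM hN =>
        cases hM with
        | lam _ _ _ hM =>
          refine hM.subst fun i hi => ?_
          cases i with
          | zero => exact hN
          | succ i => exact .var _ _ (by omega)
    | etaImp => simp [beta] at hl
    | idBox => simp [beta] at hl
    | betaBox W L Q σ M N =>
      cases hM with
      | box _ _ _ hM hB =>
        have hL : Scoped n (.box L N) := hB (σ, .box L N) (by simp)
        cases hL with
        | box _ _ _ hN hL =>
          refine .box _ _ _ ?_ fun b hb => ?_
          · have hM' : Scoped (W.length + 1 + Q.length) M := by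
              simpa [add_assoc, add_comm, add_left_comm] using hM
            simpa [add_assoc] using hM'.subst (scoped_splice hN)
          · simp only [List.mem_append] at hb
            rcases hb with (hb | hb) | hb
            exacts [hB b (by simp [hb]), hL b hb, hB b (by simp [hb])]
  | lam σ M M' _ ih =>
    cases hM with
    | lam _ _ _ hM => exact .lam _ _ _ (ih hM)
  | appLeft M M' N _ ih =>
    cases hM with
    | app _ _ _ hM hN => exact .app _ _ _ (ih hM) hN
  | appRight M N N' _ ih =>
    cases hM with
    | app _ _ _ hM hN => exact .app _ _ _ hM (ih hN)
  | boxArg B₁ B₂ σ N N' M _ ih =>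
    cases hM with
    | box _ _ _ hM hB =>
      refine .box _ _ _ (by simpa using hM) fun b hb => ?_
      simp only [List.mem_append, List.mem_cons] at hb
      rcases hb with hb | rfl | hb
      exacts [hB b (by simp [hb]), ih (hB (σ, N) (by simp)), hB b (by simp [hb])]
  | boxBody B M M' _ ih =>
    cases hM with
    | box _ _ _ hM hB => exact .box _ _ _ (ih hM) hB

theorem Steps.scoped {M N : Tm P C} (h : Steps beta M N) {n : ℕ} (hM : Scoped n M) :
    Scoped n N := by
  induction h with
  | refl => exact hM
  | tail _ h ih => exact h.scoped ih

-- Complete development and the Z-property of `β`-reduction.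

/-- Application, with contraction of the `β⊃`-redex at the root, if there is one. -/
def contractApp : Tm P C → Tm P C → Tm P C
  | .lam _ M, N => M.subst (single N)
  | M, N => .app M N

/-- The term `box W, B in M`, with contraction of the `β□`-redexes at the root that come from the
arguments in `B`. -/
def contractBox : List (Ty P × Tm P C) → List (Ty P × Tm P C) → Tm P C → Tm P C
  | W, [], M => .box W M
  | W, (_, .box L N) :: B, M =>
    contractBox (W ++ L) B (M.subst (splice W.length L.length N))
  | W, b :: B, M => contractBox (W ++ [b]) B M

mutual

/-- The result of contracting all `β`-redexes of a term from the inside out. -/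
def Tm.dev : Tm P C → Tm P C
  | .con c τ => .con c τ
  | .var i => .var i
  | .lam σ M => .lam σ M.dev
  | .app M N => contractApp M.dev N.dev
  | .box B M => contractBox [] (devArgs B) M.dev

/-- The function `Tm.dev` in each argument of a box. -/
def devArgs : List (Ty P × Tm P C) → List (Ty P × Tm P C)
  | [] => []
  | b :: B => devArg b :: devArgs B

/-- The function `Tm.dev` in one argument of a box. -/
def devArg : Ty P × Tm P C → Ty P × Tm P C
  | (σ, N) => (σ, N.dev)

end

theorem devArgs_eq_map (B : List (Ty P × Tm P C)) :
    devArgs B = B.map fun b => (b.1, b.2.dev) := by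
  induction B with
  | nil => rfl
  | cons b B ih =>
    obtain ⟨σ, N⟩ := b
    simp [devArgs, devArg, ih]

theorem dev_con (c : C) (τ : Ty P) : (Tm.con c τ).dev = .con c τ := by simp [Tm.dev]

theorem dev_var (i : ℕ) : (Tm.var i : Tm P C).dev = .var i := by simp [Tm.dev]

theorem dev_lam (σ : Ty P) (M : Tm P C) : (Tm.lam σ M).dev = .lam σ M.dev := by simp [Tm.dev]

theorem dev_app (M N : Tm P C) : (Tm.app M N).dev = contractApp M.dev N.dev := by simp [Tm.dev]

theorem dev_box (B : List (Ty P × Tm P C)) (M : Tm P C) :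
    (Tm.box B M).dev = contractBox [] (B.map fun b => (b.1, b.2.dev)) M.dev := by
  simp [Tm.dev, devArgs_eq_map]

theorem contractApp_lam (σ : Ty P) (M N : Tm P C) :
    contractApp (.lam σ M) N = M.subst (single N) := rfl

theorem contractApp_of_ne {M : Tm P C} (h : ∀ σ A, M ≠ .lam σ A) (N : Tm P C) :
    contractApp M N = .app M N := by
  cases M with
  | lam σ A => exact absurd rfl (h σ A)
  | _ => rfl

theorem contractBox_box (W L B : List (Ty P × Tm P C)) (σ : Ty P) (N M : Tm P C) :
    contractBox W ((σ, .box L N) :: B) M =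
      contractBox (W ++ L) B (M.subst (splice W.length L.length N)) := by
  simp [contractBox]

theorem contractBox_of_ne {K : Tm P C} (h : ∀ L N, K ≠ .box L N) (σ : Ty P)
    (W B : List (Ty P × Tm P C)) (M : Tm P C) :
    contractBox W ((σ, K) :: B) M = contractBox (W ++ [(σ, K)]) B M := by
  cases K with
  | box L N => exact absurd rfl (h L N)
  | _ => simp [contractBox]

theorem Tm.eq_box_or_ne (M : Tm P C) : (∃ L N, M = .box L N) ∨ ∀ L N, M ≠ .box L N := by
  cases M <;> simp

theorem Tm.eq_lam_or_ne (M : Tm P C) : (∃ σ A, M = .lam σ A) ∨ ∀ σ A, M ≠ .lam σ A := by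
  cases M <;> simp

theorem splice_comm' {W L L' U : List (Ty P × Tm P C)} (M : Tm P C) {N : Tm P C} (N' : Tm P C)
    (hN : Scoped L.length N) (b : Ty P × Tm P C) :
    (M.subst (splice (W ++ b :: U).length L'.length N')).subst (splice W.length L.length N) =
      (M.subst (splice W.length L.length N)).subst
        (splice (W ++ L ++ U).length L'.length N') := by
  have := splice_comm W.length U.length L.length L'.length M N' hN
  simpa [add_assoc, add_comm, add_left_comm] using this

theorem splice_splice' {W K R : List (Ty P × Tm P C)} (J : List (Ty P × Tm P C)) (M N D : Tm P C)
    (b : Ty P × Tm P C) :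
    (M.subst (splice W.length (K ++ b :: R).length N)).subst
        (splice (W ++ K).length J.length D) =
      M.subst (splice W.length (K ++ J ++ R).length (N.subst (splice K.length J.length D))) := by
  have := splice_splice W.length K.length J.length R.length M N D
  simpa [add_assoc, add_comm, add_left_comm] using this

theorem contractApp_steps (M N : Tm P C) : Steps beta (.app M N) (contractApp M N) := by
  rcases M.eq_lam_or_ne with ⟨σ, A, rfl⟩ | h
  · exact .single (.beta_imp _ _ _)
  · rw [contractApp_of_ne h]

theorem contractBox_steps (B W : List (Ty P × Tm P C)) (M : Tm P C) :
    Steps beta (.box (W ++ B) M) (contractBox W B M) := by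
  induction B generalizing W M with
  | nil => simpa [contractBox] using .refl
  | cons b B ih =>
    obtain ⟨σ, K⟩ := b
    rcases K.eq_box_or_ne with ⟨L, N, rfl⟩ | h
    · rw [contractBox_box]
      exact .head (.beta_box _ _ _ _ _ _) (ih _ _)
    · rw [contractBox_of_ne h]
      simpa using ih (W ++ [(σ, K)]) M

theorem dev_steps (M : Tm P C) : Steps beta M M.dev := by
  induction M using Tm.ind with
  | con c τ => rw [dev_con]
  | var i => rw [dev_var]
  | lam σ M ih =>
    rw [dev_lam]
    exact ih.lam σ
  | app M N ihM ihN =>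
    rw [dev_app]
    exact (ihM.app ihN).trans (contractApp_steps _ _)
  | box B M ihB ihM =>
    rw [dev_box]
    have h := Steps.box_map id Tm.dev B M ihB
    simp only [id, Prod.mk.eta, List.map_id'] at h
    exact (h.trans (Steps.boxBody _ ihM)).trans (contractBox_steps _ [] _)

theorem box_dev_args (W B Q : List (Ty P × Tm P C)) (M : Tm P C) :
    Steps beta (.box (W ++ B ++ Q) M) (.box (W ++ (B.map fun b => (b.1, b.2.dev)) ++ Q) M) := by
  induction B generalizing W with
  | nil => exact .refl
  | cons b B ih =>
    have h := Steps.boxArg W (B ++ Q) b.1 M (dev_steps b.2)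
    refine .trans (by simpa using h) ?_
    simpa using ih (W ++ [(b.1, b.2.dev)])

theorem contractBox_body (B W : List (Ty P × Tm P C)) {M M' : Tm P C} (h : Steps beta M M') :
    Steps beta (contractBox W B M) (contractBox W B M') := by
  induction B generalizing W M M' with
  | nil => simpa [contractBox] using h.boxBody W
  | cons b B ih =>
    obtain ⟨σ, K⟩ := b
    rcases K.eq_box_or_ne with ⟨L, N, rfl⟩ | hK
    · rw [contractBox_box, contractBox_box]
      exact ih _ (h.subst _)
    · rw [contractBox_of_ne hK, contractBox_of_ne hK]
      exact ih _ h

theorem contractBox_left (B W₁ W₂ : List (Ty P × Tm P C)) (σ : Ty P) (M : Tm P C)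
    {N N' : Tm P C} (h : Steps beta N N') :
    Steps beta (contractBox (W₁ ++ (σ, N) :: W₂) B M) (contractBox (W₁ ++ (σ, N') :: W₂) B M) := by
  induction B generalizing W₂ M with
  | nil => simpa [contractBox] using h.boxArg W₁ W₂ σ M
  | cons b B ih =>
    obtain ⟨ρ, K⟩ := b
    rcases K.eq_box_or_ne with ⟨L, D, rfl⟩ | hK
    · rw [contractBox_box, contractBox_box]
      simpa using ih (W₂ ++ L) (M.subst (splice (W₁ ++ (σ, N) :: W₂).length L.length D))
    · rw [contractBox_of_ne hK, contractBox_of_ne hK]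
      simpa using ih (W₂ ++ [(ρ, K)]) M

/-- A box that has already been passed over remains a redex throughout the contraction of `B`.
Contracting it before or after `B` gives the same term, by `splice_comm'`. -/
theorem contractBox_left_box (B W₁ L W₂ : List (Ty P × Tm P C)) (σ : Ty P) (M : Tm P C)
    {N : Tm P C} (hN : Scoped L.length N) :
    Steps beta (contractBox (W₁ ++ (σ, .box L N) :: W₂) B M)
      (contractBox (W₁ ++ L ++ W₂) B (M.subst (splice W₁.length L.length N))) := by
  induction B generalizing W₂ M with
  | nil => simpa only [contractBox] using .single (.beta_box _ _ _ _ _ _)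
  | cons b B ih =>
    obtain ⟨ρ, K⟩ := b
    rcases K.eq_box_or_ne with ⟨J, D, rfl⟩ | hK
    · rw [contractBox_box, contractBox_box, ← splice_comm' M D hN (σ, .box L N)]
      simpa using ih (W₂ ++ J) (M.subst (splice (W₁ ++ (σ, .box L N) :: W₂).length J.length D))
    · rw [contractBox_of_ne hK, contractBox_of_ne hK]
      simpa using ih (W₂ ++ [(ρ, K)]) M

theorem Scoped.of_box {n : ℕ} {L : List (Ty P × Tm P C)} {N : Tm P C} (h : Scoped n (.box L N)) :
    Scoped L.length N := by
  cases h with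
  | box _ _ _ hM _ => exact hM

/-- Reduction in the argument that is contracted first. -/
theorem Step.contractBox_cons (B W : List (Ty P × Tm P C)) (σ : Ty P) (M : Tm P C)
    {n : ℕ} {N N' : Tm P C} (hN : Scoped n N) (h : Step beta N N') :
    Steps beta (contractBox W ((σ, N) :: B) M) (contractBox W ((σ, N') :: B) M) := by
  rcases N.eq_box_or_ne with ⟨L, D, rfl⟩ | hK
  · rw [contractBox_box]
    cases h with
    | rule l hl _ _ h =>
      cases h with
      | idBox => simp [beta] at hl
      | betaBox V J R ρ _ E =>
        have hE : Scoped J.length E := by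
          cases hN with
          | box _ _ _ _ hB =>
            have : Scoped n (.box J E) := hB (ρ, .box J E) (by simp)
            exact this.of_box
        -- On the left the inner redex has moved into the part already passed over, where
        -- `contractBox_left_box` contracts it.
        rw [contractBox_box, ← splice_splice' J M D E (ρ, .box J E)]
        simpa using contractBox_left_box B (W ++ V) J R ρ
          (M.subst (splice W.length (V ++ (ρ, .box J E) :: R).length D)) hE
    | boxArg B₁ B₂ ρ E E' _ h =>
      rw [contractBox_box]
      simpa using contractBox_left B (W ++ B₁) B₂ ρ
        (M.subst (splice W.length (B₁ ++ (ρ, E) :: B₂).length D)) (.single h)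
    | boxBody _ _ D' h =>
      rw [contractBox_box]
      exact contractBox_body _ _ (Steps.subst_splice _ _ _ (.single h))
  · rw [contractBox_of_ne hK]
    -- Here the argument was passed over as it was not a box. If the step turns it into one, the
    -- right-hand side contracts it, and the left-hand side must catch up by a further `β□`-step.
    have h₁ := contractBox_left B W [] σ M (.single h)
    rcases N'.eq_box_or_ne with ⟨L, D, rfl⟩ | hK'
    · rw [contractBox_box]
      refine h₁.trans ?_
      simpa using contractBox_left_box B W L [] σ M (h.scoped hN).of_box
    · rwa [contractBox_of_ne hK']

theorem Steps.contractBox_cons (B W : List (Ty P × Tm P C)) (σ : Ty P) (M : Tm P C)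
    {n : ℕ} {N N' : Tm P C} (hN : Scoped n N) (h : Steps beta N N') :
    Steps beta (contractBox W ((σ, N) :: B) M) (contractBox W ((σ, N') :: B) M) := by
  induction h with
  | refl => exact .refl
  | tail h h' ih => exact ih.trans (h'.contractBox_cons B W σ M (Steps.scoped h hN))

/-- The hypothesis is needed for all `W` and `M`, since the contraction of `B₁` changes both. -/
theorem contractBox_append (B₁ B₂ B₂' : List (Ty P × Tm P C))
    (h : ∀ W M, Steps beta (contractBox W B₂ M) (contractBox W B₂' M))
    (W : List (Ty P × Tm P C)) (M : Tm P C) :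
    Steps beta (contractBox W (B₁ ++ B₂) M) (contractBox W (B₁ ++ B₂') M) := by
  induction B₁ generalizing W M with
  | nil => exact h W M
  | cons b B ih =>
    obtain ⟨ρ, K⟩ := b
    rcases K.eq_box_or_ne with ⟨J, D, rfl⟩ | hK
    · simpa only [List.cons_append, contractBox_box] using ih _ _
    · simpa only [List.cons_append, contractBox_of_ne hK] using ih _ _

theorem contractBox_map (f g : Tm P C → Tm P C) (n : ℕ) (B W : List (Ty P × Tm P C)) (M : Tm P C)
    (hB : ∀ b ∈ B, Scoped n (f b.2)) (h : ∀ b ∈ B, Steps beta (f b.2) (g b.2)) :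
    Steps beta (contractBox W (B.map fun b => (b.1, f b.2)) M)
      (contractBox W (B.map fun b => (b.1, g b.2)) M) := by
  induction B generalizing W M with
  | nil => exact .refl
  | cons b B ih =>
    refine (Steps.contractBox_cons _ W b.1 M (hB b (by simp)) (h b (by simp))).trans ?_
    exact contractBox_append [(b.1, g b.2)] _ _
      (fun W M => ih W M (fun c hc => hB c (by simp [hc])) fun c hc => h c (by simp [hc])) W M

/-- Not an equality: substitution can turn an argument into a box, and the right-hand side contracts
the new redex. Renaming creates no boxes, so `contractBox_rename` is an equality. -/
theorem contractBox_subst (n : ℕ) (s : ℕ → Tm P C) (B W : List (Ty P × Tm P C)) (M : Tm P C)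
    (hB : ∀ b ∈ B, Scoped n (b.2.subst s)) :
    Steps beta ((contractBox W B M).subst s)
      (contractBox (W.map fun b => (b.1, b.2.subst s)) (B.map fun b => (b.1, b.2.subst s)) M) := by
  induction B generalizing W M with
  | nil => simpa [contractBox] using .refl
  | cons b B ih =>
    obtain ⟨σ, K⟩ := b
    have ih := fun W M => ih W M fun c hc => hB c (by simp [hc])
    rcases K.eq_box_or_ne with ⟨L, N, rfl⟩ | hK
    · simp only [contractBox_box, List.map_cons, subst_box]
      simpa using ih (W ++ L) (M.subst (splice W.length L.length N))
    · rw [contractBox_of_ne hK]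
      refine (ih _ _).trans ?_
      simp only [List.map_append, List.map_cons, List.map_nil]
      have hK' := hB (σ, K) (by simp)
      dsimp only at hK'
      rcases (K.subst s).eq_box_or_ne with ⟨L, N, h⟩ | h
      · rw [h] at hK' ⊢
        rw [contractBox_box]
        simpa using contractBox_left_box (B.map fun b => (b.1, b.2.subst s))
          (W.map fun b => (b.1, b.2.subst s)) L [] σ M hK'.of_box
      · rw [contractBox_of_ne h]

theorem contractBox_rename (ρ : ℕ → ℕ) (B W : List (Ty P × Tm P C)) (M : Tm P C) :
    (contractBox W B M).rename ρ =
      contractBox (W.map fun b => (b.1, b.2.rename ρ)) (B.map fun b => (b.1, b.2.rename ρ)) M := by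
  induction B generalizing W M with
  | nil => simp [contractBox]
  | cons b B ih =>
    obtain ⟨σ, K⟩ := b
    rcases K.eq_box_or_ne with ⟨L, N, rfl⟩ | hK
    · simp [contractBox_box, ih]
    · have hK' : ∀ L N, K.rename ρ ≠ .box L N := by
        cases K with
        | box L N => exact absurd rfl (hK L N)
        | _ => simp
      rw [contractBox_of_ne hK, List.map_cons, contractBox_of_ne hK', ih]
      simp

theorem contractApp_rename (ρ : ℕ → ℕ) (M N : Tm P C) :
    (contractApp M N).rename ρ = contractApp (M.rename ρ) (N.rename ρ) := by
  cases M with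
  | lam σ A => simp [contractApp_lam, rename_single_rename]
  | _ => simp [contractApp]

theorem dev_rename (M : Tm P C) (ρ : ℕ → ℕ) : (M.rename ρ).dev = M.dev.rename ρ := by
  induction M using Tm.ind generalizing ρ with
  | con | var => simp [dev_con, dev_var]
  | lam σ M ih => simp [dev_lam, ih]
  | app M N ihM ihN => simp [dev_app, ihM, ihN, contractApp_rename]
  | box B M ihB _ =>
    simp only [dev_box, rename_box, contractBox_rename, List.map_map, List.map_nil]
    congr 1
    exact List.map_congr_left fun b hb => by simp [ihB b hb]

theorem Steps.contractApp {M M' N N' : Tm P C} (hM : Steps beta M M') (hN : Steps beta N N') :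
    Steps beta (contractApp M N) (contractApp M' N') := by
  rcases M.eq_lam_or_ne with ⟨σ, A, rfl⟩ | h
  · obtain ⟨A', rfl, hA⟩ := hM.lam_inv
    exact (hA.subst _).trans (Steps.subst_single _ hN)
  · rw [contractApp_of_ne h]
    exact (hM.app hN).trans (contractApp_steps _ _)

theorem dev_upSubst (s : ℕ → Tm P C) :
    (fun i => (upSubst s i).dev) = upSubst fun i => (s i).dev := by
  funext i
  cases i with
  | zero => simp [dev_var]
  | succ i => simp [dev_rename]

theorem dev_single (N : Tm P C) : (fun i => (single N i).dev) = single N.dev := by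
  funext i
  cases i with
  | zero => simp
  | succ i => simp [dev_var]

theorem dev_splice (a l : ℕ) (N : Tm P C) : (fun i => (splice a l N i).dev) = splice a l N.dev := by
  funext i
  unfold splice
  split_ifs <;> simp [dev_var, dev_rename]

theorem Scoped.dev {n : ℕ} {M : Tm P C} (h : Scoped n M) : Scoped n M.dev :=
  (dev_steps M).scoped h

/-- A reduction rather than an equality, because substituting after development can create redexes
that the development of the substituted term contracts. -/
theorem dev_subst_steps {n m : ℕ} {M : Tm P C} (hM : Scoped n M) {s : ℕ → Tm P C}
    (hs : ∀ i < n, Scoped m (s i)) :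
    Steps beta (M.dev.subst fun i => (s i).dev) (M.subst s).dev := by
  induction M using Tm.ind generalizing n m s with
  | con c τ => simpa [dev_con] using .refl
  | var i => simpa [dev_var] using .refl
  | lam σ M ih =>
    cases hM with
    | lam _ _ _ hM =>
      simp only [dev_lam, subst_lam, ← dev_upSubst]
      refine Steps.lam σ (ih hM (m := m + 1) fun i hi => ?_)
      cases i with
      | zero => exact .var _ _ (by omega)
      | succ i => exact (hs i (by omega)).rename fun j hj => by omega
  | app M N ihM ihN =>
    cases hM with
    | app _ _ _ hM hN =>
      rw [dev_app, subst_app, dev_app]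
      refine .trans ?_ (Steps.contractApp (ihM hM hs) (ihN hN hs))
      rcases M.dev.eq_lam_or_ne with ⟨σ, A, h⟩ | h
      · simpa [h, contractApp_lam, subst_single_subst] using .refl
      · rw [contractApp_of_ne h, subst_app]
        exact contractApp_steps _ _
  | box B M ihB _ =>
    cases hM with
    | box _ _ _ hM hB =>
      have hB' : ∀ b ∈ B, Scoped m (b.2.dev.subst fun i => (s i).dev) := fun b hb =>
        (hB b hb).dev.subst fun i hi => (hs i hi).dev
      rw [dev_box, subst_box, dev_box, List.map_map]
      refine (contractBox_subst m _ _ _ _ ?_).trans ?_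
      · intro b hb
        obtain ⟨c, hc, rfl⟩ := List.mem_map.1 hb
        exact hB' c hc
      · rw [List.map_map]
        exact contractBox_map (fun N => N.dev.subst fun i => (s i).dev) (fun N => (N.subst s).dev)
          m B _ _ hB' fun b hb => ihB b hb (hB b hb) hs

/-- Once the box `L` has been contracted, the redexes among `B` and `Q` are still there. Those in
`B` may be contracted late, although the right-hand side takes them first, by `splice_comm'`. -/
theorem spliced_steps_contractBox (B W L Q : List (Ty P × Tm P C)) (σ : Ty P) (M N : Tm P C)
    {n : ℕ} (hB : ∀ b ∈ B, Scoped n b.2) :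
    Steps beta (.box (W ++ B ++ L ++ Q) (M.subst (splice (W ++ B).length L.length N)))
      (contractBox W (B ++ (σ, .box L N) :: Q) M) := by
  induction B generalizing W M with
  | nil =>
    simp only [List.nil_append, List.append_nil, contractBox_box]
    exact contractBox_steps _ _ _
  | cons b B ih =>
    have ih := fun W M => ih W M fun c hc => hB c (by simp [hc])
    obtain ⟨ρ, K⟩ := b
    rcases K.eq_box_or_ne with ⟨J, D, rfl⟩ | hK
    · rw [List.cons_append, contractBox_box]
      refine .trans (.single ?_) (ih _ _)
      have := Step.beta_box W J (B ++ L ++ Q) ρ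
        (M.subst (splice (W ++ (ρ, .box J D) :: B).length L.length N)) D
      rw [splice_comm' M N (hB (ρ, .box J D) (by simp)).of_box] at this
      simpa using this
    · rw [List.cons_append, contractBox_of_ne hK]
      simpa using ih (W ++ [(ρ, K)]) M

/-- Associativity of flattening: contracting inside the inner box and then merging it, or merging
first and contracting in the outer box, agree by `splice_splice'`. The list `K` is the accumulator
of the inner contraction. -/
theorem contractBox_contractBox (L W K Q : List (Ty P × Tm P C)) (σ : Ty P) (M N : Tm P C) :
    contractBox W ((σ, contractBox K L N) :: Q) M =
      contractBox (W ++ K) (L ++ Q) (M.subst (splice W.length (K ++ L).length N)) := by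
  induction L generalizing K N with
  | nil => simp [contractBox]
  | cons b L ih =>
    obtain ⟨ρ, E⟩ := b
    rcases E.eq_box_or_ne with ⟨J, D, rfl⟩ | hE
    · rw [contractBox_box, ih, List.cons_append, contractBox_box, splice_splice']
      simp
    · rw [contractBox_of_ne hE, ih, List.cons_append, contractBox_of_ne hE]
      simp

theorem contractBox_nested (B W L Q : List (Ty P × Tm P C)) (σ : Ty P) (M N : Tm P C)
    {n : ℕ} (hB : ∀ b ∈ B, Scoped n b.2) :
    contractBox W (B ++ (σ, contractBox [] L N) :: Q) M =
      contractBox W (B ++ L ++ Q) (M.subst (splice (W ++ B).length L.length N)) := by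
  induction B generalizing W M with
  | nil => simpa using contractBox_contractBox L W [] Q σ M N
  | cons b B ih =>
    have ih := fun W M => ih W M fun c hc => hB c (by simp [hc])
    obtain ⟨ρ, K⟩ := b
    rcases K.eq_box_or_ne with ⟨J, D, rfl⟩ | hK
    · simp only [List.cons_append, contractBox_box, ih]
      rw [splice_comm' M N (hB (ρ, .box J D) (by simp)).of_box]
    · simp only [List.cons_append, contractBox_of_ne hK, ih]
      simp

/-- The `Z`-property of `β`-reduction. -/
theorem Step.dev {M N : Tm P C} (h : Step beta M N) {n : ℕ} (hM : Scoped n M) :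
    Steps beta N M.dev ∧ Steps beta M.dev N.dev := by
  induction h generalizing n with
  | rule l hl M N h =>
    cases h with
    | betaImp σ M N =>
      cases hM with
      | app _ _ _ hM hN =>
        cases hM with
        | lam _ _ _ hM =>
          rw [dev_app, dev_lam, contractApp_lam]
          refine ⟨((dev_steps M).subst _).trans (Steps.subst_single _ (dev_steps N)), ?_⟩
          rw [← dev_single]
          refine dev_subst_steps hM (m := n) fun i hi => ?_
          cases i with
          | zero => exact hN
          | succ i => exact .var _ _ (by omega)
    | etaImp => simp [beta] at hl
    | idBox => simp [beta] at hl
    | betaBox W L Q σ M N =>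
      cases hM with
      | box _ _ _ hM hB =>
        have hL : Scoped n (.box L N) := hB (σ, .box L N) (by simp)
        have hW : ∀ b ∈ W.map fun b => (b.1, b.2.dev), Scoped n b.2 := by
          intro b hb
          obtain ⟨c, hc, rfl⟩ := List.mem_map.1 hb
          exact (hB c (by simp [hc])).dev
        have hM' : Scoped (W.length + 1 + Q.length) M := by
          simpa [add_assoc, add_comm, add_left_comm] using hM
        constructor
        -- The development of a box is a box, and by `Steps.box_inv` the reduction leading to it can
        -- be replayed after the `β□`-contraction.
        · obtain ⟨L', N', h, hLN⟩ := (dev_steps (.box L N)).box_inv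
          rw [dev_box, List.map_append, List.map_cons, h]
          refine (hLN _ _ _).trans ?_
          refine .trans ?_ (by
            simpa using spliced_steps_contractBox _ [] L' (Q.map fun b => (b.1, b.2.dev)) σ
              M.dev N' hW)
          refine .trans (Steps.boxBody _ ((dev_steps M).subst _)) ?_
          rw [List.append_assoc]
          refine .trans (box_dev_args [] W (L' ++ Q) _) ?_
          simpa using box_dev_args (W.map (fun b => (b.1, b.2.dev)) ++ L') Q [] _
        · simp only [dev_box, List.map_append, List.map_cons]
          rw [contractBox_nested _ _ _ _ _ _ _ hW]
          refine contractBox_body _ _ ?_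
          have := dev_subst_steps hM' (scoped_splice (a := W.length) (q := Q.length) hL.of_box)
          rw [dev_splice] at this
          simpa using this
  | lam σ M M' _ ih =>
    cases hM with
    | lam _ _ _ hM =>
      rw [dev_lam, dev_lam]
      exact ⟨(ih hM).1.lam σ, (ih hM).2.lam σ⟩
  | appLeft M M' N _ ih =>
    cases hM with
    | app _ _ _ hM hN =>
      rw [dev_app, dev_app]
      exact ⟨((ih hM).1.app (dev_steps N)).trans (contractApp_steps _ _),
        (ih hM).2.contractApp .refl⟩
  | appRight M N N' _ ih =>
    cases hM with
    | app _ _ _ hM hN =>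
      rw [dev_app, dev_app]
      exact ⟨((dev_steps M).app (ih hN).1).trans (contractApp_steps _ _),
        Steps.contractApp .refl (ih hN).2⟩
  | boxArg B₁ B₂ σ N N' M _ ih =>
    cases hM with
    | box _ _ _ hM hB =>
      have hN : Scoped n N := hB (σ, N) (by simp)
      constructor
      · refine (Steps.boxArg _ _ _ _ (ih hN).1).trans ?_
        rw [dev_box, List.map_append, List.map_cons]
        refine .trans (Steps.boxBody _ (dev_steps M)) (.trans ?_ (contractBox_steps _ [] _))
        refine .trans (box_dev_args [] B₁ ((σ, N.dev) :: B₂) _) ?_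
        simpa using box_dev_args (B₁.map (fun b => (b.1, b.2.dev)) ++ [(σ, N.dev)]) B₂ [] M.dev
      · simp only [dev_box, List.map_append, List.map_cons]
        exact contractBox_append _ _ _
          (fun W M => Steps.contractBox_cons _ W σ M hN.dev (ih hN).2) _ _
  | boxBody B M M' _ ih =>
    cases hM with
    | box _ _ _ hM hB =>
      rw [dev_box, dev_box]
      refine ⟨?_, contractBox_body _ _ (ih hM).2⟩
      refine .trans (Steps.boxBody _ (ih hM).1) (.trans ?_ (contractBox_steps _ [] _))
      simpa using box_dev_args [] B [] M.dev

theorem beta_confluent {n : ℕ} {M N₁ N₂ : Tm P C} (hM : Scoped n M) (h₁ : Steps beta M N₁)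
    (h₂ : Steps beta M N₂) : ∃ L, Steps beta N₁ L ∧ Steps beta N₂ L := by
  have dev_mono : ∀ {A B : Tm P C}, Scoped n A → Steps beta A B → Steps beta A.dev B.dev := by
    intro A B hA h
    induction h with
    | refl => exact .refl
    | tail h h' ih => exact ih.trans (h'.dev (Steps.scoped h hA)).2
  induction h₁ with
  | refl => exact ⟨N₂, h₂, .refl⟩
  | tail h h' ih =>
    obtain ⟨L, hL, hL'⟩ := ih
    have hs := Steps.scoped h hM
    -- Along the new step the reduct goes to the development of its source, which goes to `L.dev` by
    -- monotonicity.
    exact ⟨L.dev, (h'.dev hs).1.trans (dev_mono hs hL), hL'.trans (dev_steps L)⟩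

-- Reductions of renamed terms.

/-- Renaming along a pullback square of renamings. -/
theorem rename_pullback {M K : Tm P C} {ρ δ ρ' δ' : ℕ → ℕ}
    (h : ∀ i j, ρ' i = δ' j → ∃ k, δ k = i ∧ ρ k = j) (e : M.rename ρ' = K.rename δ') :
    ∃ M₀ : Tm P C, M = M₀.rename δ ∧ K = M₀.rename ρ := by
  induction M using Tm.ind generalizing K ρ δ ρ' δ' with
  | con c τ =>
    cases K <;> simp at e
    obtain ⟨rfl, rfl⟩ := e
    exact ⟨.con c τ, by simp⟩
  | var i =>
    cases K <;> simp at e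
    obtain ⟨k, rfl, rfl⟩ := h _ _ e
    exact ⟨.var k, by simp⟩
  | lam σ M ih =>
    cases K <;> simp at e
    obtain ⟨rfl, e⟩ := e
    have h' : ∀ i j, upRen ρ' i = upRen δ' j → ∃ k, upRen δ k = i ∧ upRen ρ k = j := by
      intro i j hij
      cases i <;> cases j <;> simp at hij
      · exact ⟨0, rfl, rfl⟩
      · obtain ⟨k, rfl, rfl⟩ := h _ _ hij
        exact ⟨k + 1, rfl, rfl⟩
    obtain ⟨M₀, rfl, rfl⟩ := ih h' e
    exact ⟨.lam σ M₀, by simp⟩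
  | app M N ihM ihN =>
    cases K <;> simp at e
    obtain ⟨M₀, rfl, rfl⟩ := ihM h e.1
    obtain ⟨N₀, rfl, rfl⟩ := ihN h e.2
    exact ⟨.app M₀ N₀, by simp⟩
  | box B M ihB _ =>
    cases K with
    | box B' M' =>
      simp only [rename_box, Tm.box.injEq] at e
      obtain ⟨e, rfl⟩ := e
      suffices ∃ B₀ : List (Ty P × Tm P C), B = B₀.map (fun b => (b.1, b.2.rename δ)) ∧
          B' = B₀.map fun b => (b.1, b.2.rename ρ) by
        obtain ⟨B₀, rfl, rfl⟩ := this
        exact ⟨.box B₀ M, by simp⟩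
      induction B generalizing B' with
      | nil =>
        obtain rfl := List.map_eq_nil_iff.1 e.symm
        exact ⟨[], rfl, rfl⟩
      | cons b B ih =>
        cases B' with
        | nil => simp at e
        | cons b' B' =>
          obtain ⟨σ, N⟩ := b
          obtain ⟨σ', N'⟩ := b'
          simp only [List.map_cons, List.cons.injEq, Prod.mk.injEq] at e
          obtain ⟨⟨rfl, e₁⟩, e₂⟩ := e
          obtain ⟨N₀, rfl, rfl⟩ := ihB _ List.mem_cons_self h e₁
          obtain ⟨B₀, rfl, rfl⟩ := ih (fun c hc => ihB c (List.mem_cons_of_mem _ hc)) B' e₂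
          exact ⟨(σ, N₀) :: B₀, by simp⟩
    | _ => simp at e

theorem map_rename_eq_append {B B₁ B₂ : List (Ty P × Tm P C)} {σ : Ty P} {N : Tm P C} {ρ : ℕ → ℕ}
    (h : (B.map fun b => (b.1, b.2.rename ρ)) = B₁ ++ (σ, N) :: B₂) :
    ∃ D₁ D₂ K, B = D₁ ++ (σ, K) :: D₂ ∧ (D₁.map fun b => (b.1, b.2.rename ρ)) = B₁ ∧
      (D₂.map fun b => (b.1, b.2.rename ρ)) = B₂ ∧ K.rename ρ = N := by
  obtain ⟨D₁, D, rfl, h₁, h₂⟩ := List.map_eq_append_iff.1 h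
  obtain ⟨⟨σ', K⟩, D₂, rfl, h₃, h₄⟩ := List.map_eq_cons_iff.1 h₂
  simp only [Prod.mk.injEq] at h₃
  obtain ⟨rfl, rfl⟩ := h₃
  exact ⟨D₁, D₂, K, rfl, h₁, h₄, rfl⟩

/-- Renaming creates no redexes, even when `ρ` is not injective. This lets a step inside the `M` of
an `η⊃`-redex `λx.Mx` be pulled back out of the binder. -/
theorem Rule.rename_inv {l : Label} {M N : Tm P C} {ρ : ℕ → ℕ} (h : Rule l (M.rename ρ) N) :
    ∃ N₀, N = N₀.rename ρ ∧ Rule l M N₀ := by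
  generalize e : M.rename ρ = K at h
  cases h with
  | betaImp σ A D =>
    cases M with
    | app M₁ M₂ =>
      cases M₁ <;> simp at e
      obtain ⟨⟨rfl, rfl⟩, rfl⟩ := e
      exact ⟨_, (rename_single_rename _ _ _).symm, .betaImp _ _ _⟩
    | _ => simp at e
  | etaImp σ A =>
    cases M with
    | lam σ' M =>
      cases M with
      | app M₁ M₂ =>
        cases M₂ <;> simp at e
        rename_i i
        obtain ⟨rfl, e, hi⟩ := e
        cases i <;> simp at hi
        -- `upRen ρ` sends only `0` to `0`, so a term avoids the bound variable if its renaming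
        -- does.
        obtain ⟨M₀, rfl, rfl⟩ := rename_pullback (δ := Nat.succ) (ρ := ρ) (fun i j hij => by
          cases i with
          | zero => simp at hij
          | succ i => exact ⟨i, rfl, by simpa using hij⟩) e
        exact ⟨M₀, rfl, .etaImp _ _⟩
      | _ => simp at e
    | _ => simp at e
  | idBox σ A =>
    cases M with
    | box B M =>
      simp only [rename_box, Tm.box.injEq] at e
      obtain ⟨e, rfl⟩ := e
      obtain ⟨D₁, D₂, K, rfl, h₁, h₂, rfl⟩ := map_rename_eq_append (B₁ := []) e
      obtain rfl := List.map_eq_nil_iff.1 h₁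
      obtain rfl := List.map_eq_nil_iff.1 h₂
      exact ⟨K, rfl, .idBox _ _⟩
    | _ => simp at e
  | betaBox W L Q σ A D =>
    cases M with
    | box B M =>
      simp only [rename_box, Tm.box.injEq] at e
      obtain ⟨e, rfl⟩ := e
      obtain ⟨D₁, D₂, K, rfl, rfl, rfl, e⟩ := map_rename_eq_append e
      cases K <;> simp at e
      obtain ⟨rfl, rfl⟩ := e
      exact ⟨_, by simp, .betaBox _ _ _ _ _ _⟩
    | _ => simp at e

theorem Step.rename_inv {X : Set Label} {M N : Tm P C} {ρ : ℕ → ℕ} (h : Step X (M.rename ρ) N) :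
    ∃ N₀, N = N₀.rename ρ ∧ Step X M N₀ := by
  generalize e : M.rename ρ = K at h
  induction h generalizing M ρ with
  | rule l hl K N h =>
    subst e
    obtain ⟨N₀, rfl, h'⟩ := h.rename_inv
    exact ⟨N₀, rfl, .rule l hl _ _ h'⟩
  | lam σ A A' _ ih =>
    cases M <;> simp at e
    obtain ⟨rfl, e⟩ := e
    obtain ⟨N₀, rfl, h⟩ := ih e
    exact ⟨.lam _ N₀, by simp, .lam _ _ _ h⟩
  | appLeft A A' D _ ih =>
    cases M <;> simp at e
    obtain ⟨e, rfl⟩ := e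
    obtain ⟨N₀, rfl, h⟩ := ih e
    exact ⟨.app N₀ _, by simp, .appLeft _ _ _ h⟩
  | appRight A D D' _ ih =>
    cases M <;> simp at e
    obtain ⟨rfl, e⟩ := e
    obtain ⟨N₀, rfl, h⟩ := ih e
    exact ⟨.app _ N₀, by simp, .appRight _ _ _ h⟩
  | boxArg B₁ B₂ σ D D' A _ ih =>
    cases M with
    | box B M =>
      simp only [rename_box, Tm.box.injEq] at e
      obtain ⟨e, rfl⟩ := e
      obtain ⟨D₁, D₂, K, rfl, rfl, rfl, e'⟩ := map_rename_eq_append e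
      obtain ⟨N₀, rfl, h⟩ := ih e'
      exact ⟨.box (D₁ ++ (σ, N₀) :: D₂) M, by simp, .boxArg _ _ _ _ _ _ h⟩
    | _ => simp at e
  | boxBody B A A' h _ =>
    cases M <;> simp at e
    obtain ⟨rfl, rfl⟩ := e
    exact ⟨.box _ A', by simp, .boxBody _ _ _ h⟩

-- Typing and subject reduction.

theorem Typing.scoped {Γ : List (Ty P)} {M : Tm P C} {τ : Ty P} (h : Typing Γ M τ) :
    Scoped Γ.length M := by
  induction h with
  | con Γ c τ => exact .con _ _ _
  | var Γ i τ h => exact .var _ _ (List.getElem?_eq_some_iff.1 h).1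
  | lam Γ σ τ M _ ih => exact .lam _ _ _ ih
  | app Γ σ τ M N _ _ ihM ihN => exact .app _ _ _ ihM ihN
  | box Γ τ B M _ _ ihM ihB => exact .box _ _ _ (by simpa using ihM) ihB

theorem Typing.rename {Γ Δ : List (Ty P)} {M : Tm P C} {τ : Ty P} (h : Typing Γ M τ) {ρ : ℕ → ℕ}
    (hρ : ∀ i σ, Γ[i]? = some σ → Δ[ρ i]? = some σ) : Typing Δ (M.rename ρ) τ := by
  induction h generalizing Δ ρ with
  | con Γ c τ =>
    rw [rename_con]
    exact .con _ _ _
  | var Γ i τ h =>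
    rw [rename_var]
    exact .var _ _ _ (hρ _ _ h)
  | lam Γ σ τ M _ ih =>
    rw [rename_lam]
    refine .lam _ _ _ _ (ih fun i ν hi => ?_)
    cases i with
    | zero => simpa using hi
    | succ i => simpa using hρ i ν (by simpa using hi)
  | app Γ σ τ M N _ _ ihM ihN =>
    rw [rename_app]
    exact .app _ _ _ _ _ (ihM hρ) (ihN hρ)
  | box Γ τ B M hM _ _ ihB =>
    rw [rename_box]
    refine .box _ _ _ _ (by simpa [Function.comp_def] using hM) fun b hb => ?_
    obtain ⟨c, hc, rfl⟩ := List.mem_map.1 hb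
    exact ihB c hc hρ

/-- Strengthening, for subject reduction of `η⊃`. -/
theorem Typing.of_rename {Γ Δ : List (Ty P)} {M : Tm P C} {τ : Ty P} {ρ : ℕ → ℕ}
    (h : Typing Δ (M.rename ρ) τ) (hρ : ∀ i, Δ[ρ i]? = Γ[i]?) : Typing Γ M τ := by
  induction M using Tm.ind generalizing Γ Δ τ ρ with
  | con c τ' =>
    rw [rename_con] at h
    cases h
    exact .con _ _ _
  | var i =>
    rw [rename_var] at h
    cases h with
    | var _ _ _ h => exact .var _ _ _ (hρ i ▸ h)
  | lam σ M ih =>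
    rw [rename_lam] at h
    cases h with
    | lam _ _ _ _ h =>
      refine .lam _ _ _ _ (ih h fun i => ?_)
      cases i with
      | zero => simp
      | succ i => simpa using hρ i
  | app M N ihM ihN =>
    rw [rename_app] at h
    cases h with
    | app _ _ _ _ _ hM hN => exact .app _ _ _ _ _ (ihM hM hρ) (ihN hN hρ)
  | box B M ihB _ =>
    rw [rename_box] at h
    cases h with
    | box _ _ _ _ hM hB =>
      refine .box _ _ _ _ (by simpa [Function.comp_def] using hM) fun b hb => ?_
      exact ihB b hb (hB (b.1, b.2.rename ρ) (List.mem_map.2 ⟨b, hb, rfl⟩)) hρ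

theorem Typing.subst {Γ Δ : List (Ty P)} {M : Tm P C} {τ : Ty P} (h : Typing Γ M τ)
    {s : ℕ → Tm P C} (hs : ∀ i σ, Γ[i]? = some σ → Typing Δ (s i) σ) :
    Typing Δ (M.subst s) τ := by
  induction h generalizing Δ s with
  | con Γ c τ =>
    rw [subst_con]
    exact .con _ _ _
  | var Γ i τ h =>
    rw [subst_var]
    exact hs _ _ h
  | lam Γ σ τ M _ ih =>
    rw [subst_lam]
    refine .lam _ _ _ _ (ih fun i ν hi => ?_)
    cases i with
    | zero => exact .var _ _ _ (by simpa using hi)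
    | succ i => exact (hs i ν (by simpa using hi)).rename fun j ν hj => by simpa using hj
  | app Γ σ τ M N _ _ ihM ihN =>
    rw [subst_app]
    exact .app _ _ _ _ _ (ihM hs) (ihN hs)
  | box Γ τ B M hM _ _ ihB =>
    rw [subst_box]
    refine .box _ _ _ _ (by simpa [Function.comp_def] using hM) fun b hb => ?_
    obtain ⟨c, hc, rfl⟩ := List.mem_map.1 hb
    exact ihB c hc hs

theorem typing_splice {W L Q : List (Ty P)} {σ : Ty P} {N : Tm P C} (hN : Typing L N σ) :
    ∀ i ν, (W ++ σ :: Q)[i]? = some ν → Typing (W ++ L ++ Q) (splice W.length L.length N i) ν := by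
  intro i ν hi
  unfold splice
  split_ifs with h h'
  · refine .var _ _ _ ?_
    rw [List.getElem?_append_left h] at hi
    rwa [List.append_assoc, List.getElem?_append_left h]
  · subst h'
    simp only [List.getElem?_append_right le_rfl, Nat.sub_self, List.getElem?_cons_zero,
      Option.some.injEq] at hi
    subst hi
    refine hN.rename fun j ν hj => ?_
    have hj' := (List.getElem?_eq_some_iff.1 hj).1
    rw [List.append_assoc, List.getElem?_append_right (by omega), Nat.add_sub_cancel_left,
      List.getElem?_append_left hj', hj]
  · refine .var _ _ _ ?_
    obtain ⟨k, rfl⟩ : ∃ k, i = W.length + (k + 1) := ⟨i - W.length - 1, by omega⟩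
    rw [List.getElem?_append_right (by omega), Nat.add_sub_cancel_left,
      List.getElem?_cons_succ] at hi
    rw [List.getElem?_append_right (by simp), ← hi]
    congr 1
    simp
    omega

theorem Typing.of_box {Γ : List (Ty P)} {B : List (Ty P × Tm P C)} {M : Tm P C} {τ : Ty P}
    (h : Typing Γ (.box B M) (.box τ)) :
    Typing (B.map Prod.fst) M τ ∧ ∀ b ∈ B, Typing Γ b.2 (.box b.1) := by
  cases h with
  | box _ _ _ _ hM hB => exact ⟨hM, hB⟩

theorem Step.typing {X : Set Label} {M N : Tm P C} (h : Step X M N) {Γ : List (Ty P)} {τ : Ty P}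
    (hM : Typing Γ M τ) : Typing Γ N τ := by
  induction h generalizing Γ τ with
  | rule l hl M N h =>
    cases h with
    | betaImp σ M N =>
      cases hM with
      | app _ _ _ _ _ hM hN =>
        cases hM with
        | lam _ _ _ _ hM =>
          refine hM.subst fun i ν hi => ?_
          cases i with
          | zero =>
            simp only [List.getElem?_cons_zero, Option.some.injEq] at hi
            exact hi ▸ hN
          | succ i => exact .var _ _ _ (by simpa using hi)
    | etaImp σ M =>
      cases hM with
      | lam _ _ _ _ hM =>
        cases hM with
        | app _ _ _ _ _ hM hx =>
          cases hx with
          | var _ _ _ hx =>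
            simp only [List.getElem?_cons_zero, Option.some.injEq] at hx
            subst hx
            exact hM.of_rename fun i => by simp
    | idBox σ M =>
      cases hM with
      | box _ _ _ _ hM hB =>
        cases hM with
        | var _ _ _ hx =>
          simp only [List.map_cons, List.getElem?_cons_zero, Option.some.injEq] at hx
          exact hx ▸ hB (σ, _) (by simp)
    | betaBox W L Q σ M N =>
      cases hM with
      | box _ _ _ _ hM hB =>
        obtain ⟨hN, hL⟩ := (hB (σ, .box L N) (by simp)).of_box
        refine .box _ _ _ _ ?_ fun b hb => ?_
        · simp only [List.map_append, List.map_cons] at hM ⊢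
          simpa using hM.subst (typing_splice hN)
        · simp only [List.mem_append] at hb
          rcases hb with (hb | hb) | hb
          exacts [hB b (by simp [hb]), hL b hb, hB b (by simp [hb])]
  | lam σ M M' _ ih =>
    cases hM with
    | lam _ _ _ _ hM => exact .lam _ _ _ _ (ih hM)
  | appLeft M M' N _ ih =>
    cases hM with
    | app _ _ _ _ _ hM hN => exact .app _ _ _ _ _ (ih hM) hN
  | appRight M N N' _ ih =>
    cases hM with
    | app _ _ _ _ _ hM hN => exact .app _ _ _ _ _ hM (ih hN)
  | boxArg B₁ B₂ σ N N' M _ ih =>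
    cases hM with
    | box _ _ _ _ hM hB =>
      refine .box _ _ _ _ (by simpa using hM) fun b hb => ?_
      simp only [List.mem_append, List.mem_cons] at hb
      rcases hb with hb | rfl | hb
      exacts [hB b (by simp [hb]), ih (hB (σ, N) (by simp)), hB b (by simp [hb])]
  | boxBody B M M' _ ih =>
    cases hM with
    | box _ _ _ _ hM hB => exact .box _ _ _ _ (ih hM) hB

theorem Steps.typing {X : Set Label} {M N : Tm P C} (h : Steps X M N) {Γ : List (Ty P)} {τ : Ty P}
    (hM : Typing Γ M τ) : Typing Γ N τ := by
  induction h with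
  | refl => exact hM
  | tail _ h ih => exact h.typing ih

-- Commutation of arbitrary steps with `η⊃` and `id□`.

theorem append_cons_eq_append_cons {α : Type*} {B₁ B₂ D₁ D₂ : List α} {x y : α}
    (h : B₁ ++ x :: B₂ = D₁ ++ y :: D₂) :
    (B₁ = D₁ ∧ x = y ∧ B₂ = D₂) ∨ (∃ U, D₁ = B₁ ++ x :: U ∧ B₂ = U ++ y :: D₂) ∨
      ∃ U, B₁ = D₁ ++ y :: U ∧ D₂ = U ++ x :: B₂ := by
  rcases List.append_eq_append_iff.1 h with ⟨U, rfl, hU⟩ | ⟨U, rfl, hU⟩ <;> cases U <;>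
    simp at hU <;> simp [hU]

/-- The labels of the rules `η⊃` and `id□`. -/
def etaId : Set Label := {.etaImp, .idBox}

theorem Step.not_var {X : Set Label} {i : ℕ} {N : Tm P C} : ¬ Step X (.var i) N := by
  intro h
  cases h with
  | rule l hl _ _ h => cases h

/-- Covers the critical pair of `η⊃` with a step in the body of its redex: either the step is inside
`M`, or it is a `β⊃`-step with the same effect as `η⊃`. -/
theorem Step.eta_inner {X : Set Label} {Γ : List (Ty P)} {σ τ : Ty P} {M N : Tm P C}
    (h : Step X (.app (M.rename Nat.succ) (.var 0)) N)
    (hM : Typing Γ (.lam σ (.app (M.rename Nat.succ) (.var 0))) τ) :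
    .lam σ N = M ∨ ∃ M', N = .app (M'.rename Nat.succ) (.var 0) ∧ Step X M M' := by
  generalize e : M.rename Nat.succ = K at h hM
  cases h with
  | rule l hl _ _ h =>
    cases h with
    | betaImp σ' D =>
      cases M <;> simp at e
      rename_i M
      obtain ⟨rfl, rfl⟩ := e
      left
      -- Typing forces the two binders to carry the same type.
      cases hM with
      | lam _ _ _ _ hM =>
        cases hM with
        | app _ _ _ _ _ hM hx =>
          cases hM
          cases hx with
          | var _ _ _ hx =>
            simp only [List.getElem?_cons_zero, Option.some.injEq] at hx
            subst hx
            rw [rename_subst]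
            congr 1
            exact subst_eq_self fun i => by cases i <;> rfl
  | appLeft _ K' _ h =>
    subst e
    obtain ⟨M', rfl, h'⟩ := h.rename_inv
    exact .inr ⟨M', rfl, h'⟩
  | appRight _ _ _ h => exact absurd h Step.not_var

theorem splice_zero_one_id (a : ℕ) (M : Tm P C) : M.subst (splice a 1 (.var 0)) = M := by
  refine subst_eq_self fun i => ?_
  unfold splice
  split_ifs with h h'
  · rfl
  · simp [h']
  · congr 1
    omega

/-- A root step against an arbitrary `η⊃`- or `id□`-step. -/
theorem Rule.commute {X : Set Label} {l : Label} (hl : l ∈ X) {Γ : List (Ty P)} {τ : Ty P}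
    {M N₁ N₂ : Tm P C} (h₁ : Rule l M N₁) (h₂ : Step etaId M N₂) (hM : Typing Γ M τ) :
    ∃ L, Steps etaId N₁ L ∧ ReflGen (Step X) N₂ L := by
  cases h₁ with
  | betaImp σ A D =>
    cases h₂ with
    | rule l' hl' _ _ h₂ =>
      cases h₂
      simp [etaId] at hl'
    | appLeft _ K _ h₂ =>
      generalize e : Tm.lam σ A = E at h₂
      cases h₂ with
      | rule l' hl' _ _ h₂ =>
        cases h₂ with
        | etaImp =>
          simp only [Tm.lam.injEq] at e
          obtain ⟨rfl, rfl⟩ := e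
          -- Overlap `(λx.Kx)D`: both rules give `K D`.
          refine ⟨.app K D, ?_, .refl⟩
          simpa [rename_succ_subst_single] using .refl
        | _ => simp at e
      | lam σ' A₁ A' h₂ =>
        simp only [Tm.lam.injEq] at e
        obtain ⟨rfl, rfl⟩ := e
        exact ⟨A'.subst (single D), .single (h₂.subst _), .single (.rule _ hl _ _ (.betaImp _ _ _))⟩
      | _ => simp at e
    | appRight _ _ D' h₂ =>
      exact ⟨A.subst (single D'), Steps.subst_single _ (.single h₂),
        .single (.rule _ hl _ _ (.betaImp _ _ _))⟩
  | etaImp σ A =>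
    generalize e : N₁.rename Nat.succ = A' at h₂ hM
    cases h₂ with
    | rule l' hl' _ _ h₂ =>
      cases h₂ with
      | etaImp =>
        obtain rfl := rename_succ_injective e
        exact ⟨_, .refl, .refl⟩
    | lam _ _ K h₂ =>
      subst e
      rcases h₂.eta_inner hM with rfl | ⟨A', rfl, h⟩
      · exact ⟨_, .refl, .refl⟩
      · exact ⟨A', .single h, .single (.rule _ hl _ _ (.etaImp _ _))⟩
  | idBox σ A =>
    generalize e : [(σ, N₁)] = B at h₂
    cases h₂ with
    | rule l' hl' _ _ h₂ =>
      cases h₂ with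
      | idBox =>
        simp only [List.cons.injEq, Prod.mk.injEq, and_true] at e
        obtain ⟨rfl, rfl⟩ := e
        exact ⟨_, .refl, .refl⟩
      | betaBox => simp [etaId] at hl'
    | boxArg B₁ B₂ σ' D D' _ h₂ =>
      cases B₁ <;> simp at e
      obtain ⟨⟨rfl, rfl⟩, rfl⟩ := e
      exact ⟨D', .single h₂, .single (.rule _ hl _ _ (.idBox _ _))⟩
    | boxBody _ _ _ h₂ => exact absurd h₂ Step.not_var
  | betaBox W L Q σ A D =>
    generalize e : W ++ (σ, .box L D) :: Q = B at h₂
    cases h₂ with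
    | rule l' hl' _ _ h₂ =>
      cases h₂ with
      | idBox =>
        cases W <;> simp at e
        obtain ⟨⟨rfl, rfl⟩, rfl⟩ := e
        refine ⟨.box L D, ?_, .refl⟩
        simpa [splice, rename_eq_subst, subst_id] using .refl
      | betaBox => simp [etaId] at hl'
    | boxArg B₁ B₂ σ' E E' _ h₂ =>
      rcases append_cons_eq_append_cons e with ⟨rfl, h, rfl⟩ | ⟨U, rfl, rfl⟩ | ⟨U, rfl, rfl⟩
      · simp only [Prod.mk.injEq] at h
        obtain ⟨rfl, rfl⟩ := h
        cases hM with
        | box _ _ _ _ hM hB =>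
          obtain ⟨hD, hL⟩ := (hB (σ, .box L D) (by simp)).of_box
          cases h₂ with
          | rule l' hl' _ _ h₂ =>
            cases h₂ with
            | idBox σ' K =>
              -- The two results differ at most in the type of one bound variable, `σ` or `σ'`.
              -- Typing of the body `var 0` makes these equal.
              cases hD with
              | var _ _ _ hx =>
                simp only [List.map_cons, List.getElem?_cons_zero, Option.some.injEq] at hx
                subst hx
                refine ⟨.box (W ++ [(σ', E')] ++ Q) A, ?_, ?_⟩
                · rw [List.length_singleton, splice_zero_one_id]
                · simpa using .refl
            | betaBox => simp [etaId] at hl'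
          | boxArg L₁ L₂ ρ E E' _ h₂ =>
            refine ⟨.box (W ++ (L₁ ++ (ρ, E') :: L₂) ++ Q) _, .single ?_,
              .single (.rule _ hl _ _ (.betaBox _ _ _ _ _ _))⟩
            simpa using Step.boxArg (W ++ L₁) (L₂ ++ Q) ρ E E'
              (A.subst (splice W.length (L₁.length + (L₂.length + 1)) D)) h₂
          | boxBody _ _ D' h₂ =>
            exact ⟨_, (Steps.subst_splice _ _ _ (.single h₂)).boxBody _,
              .single (.rule _ hl _ _ (.betaBox _ _ _ _ _ _))⟩
      · refine ⟨.box (W ++ L ++ (U ++ (σ', E') :: B₂)) (A.subst (splice W.length L.length D)),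
          .single ?_, .single ?_⟩
        · simpa using Step.boxArg (W ++ L ++ U) B₂ σ' E E'
            (A.subst (splice W.length L.length D)) h₂
        · simpa using Step.rule _ hl _ _ (Rule.betaBox W L (U ++ (σ', E') :: B₂) σ A D)
      · refine ⟨.box ((B₁ ++ (σ', E') :: U) ++ L ++ Q)
          (A.subst (splice (B₁ ++ (σ', E') :: U).length L.length D)), .single ?_, .single ?_⟩
        · simpa using Step.boxArg B₁ (U ++ L ++ Q) σ' E E'
            (A.subst (splice (B₁ ++ (σ', E') :: U).length L.length D)) h₂
        · simpa using Step.rule _ hl _ _ (Rule.betaBox (B₁ ++ (σ', E') :: U) L Q σ A D)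
    | boxBody _ _ A' h₂ =>
      exact ⟨_, .single (.boxBody _ _ _ (h₂.subst _)),
        .single (.rule _ hl _ _ (e ▸ .betaBox _ _ _ _ _ _))⟩

/-- The asymmetry reflects duplication: a `β`-step may copy or erase the `etaId`-redex, whereas an
`etaId`-step never copies the other redex and at worst absorbs it. -/
theorem Step.commute {X : Set Label} {Γ : List (Ty P)} {τ : Ty P} {M N₁ N₂ : Tm P C}
    (h₁ : Step X M N₁) (h₂ : Step etaId M N₂) (hM : Typing Γ M τ) :
    ∃ L, Steps etaId N₁ L ∧ ReflGen (Step X) N₂ L := by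
  have lift : ∀ (f : Tm P C → Tm P C), (∀ A B, Step X A B → Step X (f A) (f B)) →
      ∀ {A B}, ReflGen (Step X) A B → ReflGen (Step X) (f A) (f B) := by
    rintro f hf A B (_ | h)
    exacts [.refl, .single (hf _ _ h)]
  induction h₁ generalizing Γ τ N₂ with
  | rule l hl M N₁ h => exact h.commute hl h₂ hM
  | lam σ A A' h₁ ih =>
    cases h₂ with
    | rule l hl _ _ h =>
      cases h with
      | etaImp =>
        rcases h₁.eta_inner hM with h | ⟨D, rfl, h⟩
        · exact ⟨_, .refl, h ▸ .refl⟩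
        · exact ⟨D, .single (.rule _ hl _ _ (.etaImp _ _)), .single h⟩
    | lam _ _ K h₂ =>
      cases hM with
      | lam _ _ _ _ hM =>
        obtain ⟨L, hL, hL'⟩ := ih h₂ hM
        exact ⟨.lam σ L, hL.lam σ, lift (.lam σ) (fun _ _ => .lam _ _ _) hL'⟩
  | appLeft A A' D h₁ ih =>
    cases hM with
    | app _ _ _ _ _ hA hD =>
      cases h₂ with
      | rule l hl _ _ h =>
        cases h
        simp [etaId] at hl
      | appLeft _ K _ h₂ =>
        obtain ⟨L, hL, hL'⟩ := ih h₂ hA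
        exact ⟨.app L D, hL.app .refl, lift (fun L => .app L D) (fun _ _ => .appLeft _ _ _) hL'⟩
      | appRight _ _ K h₂ =>
        exact ⟨.app A' K, .single (.appRight _ _ _ h₂), .single (.appLeft _ _ _ h₁)⟩
  | appRight A D D' h₁ ih =>
    cases hM with
    | app _ _ _ _ _ hA hD =>
      cases h₂ with
      | rule l hl _ _ h =>
        cases h
        simp [etaId] at hl
      | appLeft _ K _ h₂ =>
        exact ⟨.app K D', .single (.appLeft _ _ _ h₂), .single (.appRight _ _ _ h₁)⟩
      | appRight _ _ K h₂ =>
        obtain ⟨L, hL, hL'⟩ := ih h₂ hD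
        exact ⟨.app A L, Steps.app .refl hL, lift (.app A) (fun _ _ => .appRight _ _ _) hL'⟩
  | boxArg B₁ B₂ σ D D' A h₁ ih =>
    generalize e : B₁ ++ (σ, D) :: B₂ = B at h₂
    cases h₂ with
    | rule l hl _ _ h =>
      cases h with
      | idBox =>
        cases B₁ <;> simp at e
        obtain ⟨⟨rfl, rfl⟩, rfl⟩ := e
        exact ⟨D', .single (.rule _ hl _ _ (.idBox _ _)), .single h₁⟩
      | betaBox => simp [etaId] at hl
    | boxArg D₁ D₂ σ' E E' _ h₂ =>
      rcases append_cons_eq_append_cons e with ⟨rfl, h, rfl⟩ | ⟨U, rfl, rfl⟩ | ⟨U, rfl, rfl⟩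
      · simp only [Prod.mk.injEq] at h
        obtain ⟨rfl, rfl⟩ := h
        cases hM with
        | box _ _ _ _ hM hB =>
          obtain ⟨L, hL, hL'⟩ := ih h₂ (hB (σ, D) (by simp))
          exact ⟨.box (B₁ ++ (σ, L) :: B₂) A, hL.boxArg _ _ _ _,
            lift (fun L => .box (B₁ ++ (σ, L) :: B₂) A) (fun _ _ => .boxArg _ _ _ _ _ _) hL'⟩
      · refine ⟨.box (B₁ ++ (σ, D') :: U ++ (σ', E') :: D₂) A, .single ?_, .single ?_⟩
        · simpa using Step.boxArg (B₁ ++ (σ, D') :: U) D₂ σ' E E' A h₂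
        · simpa using Step.boxArg B₁ (U ++ (σ', E') :: D₂) σ D D' A h₁
      · refine ⟨.box (D₁ ++ (σ', E') :: U ++ (σ, D') :: B₂) A, .single ?_, .single ?_⟩
        · simpa using Step.boxArg D₁ (U ++ (σ, D') :: B₂) σ' E E' A h₂
        · simpa using Step.boxArg (D₁ ++ (σ', E') :: U) B₂ σ D D' A h₁
    | boxBody _ _ A' h₂ =>
      subst e
      exact ⟨_, .single (.boxBody _ _ _ h₂), .single (.boxArg _ _ _ _ _ _ h₁)⟩
  | boxBody B A A' h₁ ih =>
    cases h₂ with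
    | rule l hl _ _ h =>
      cases h with
      | idBox => exact absurd h₁ Step.not_var
      | betaBox => simp [etaId] at hl
    | boxArg D₁ D₂ σ' E E' _ h₂ =>
      exact ⟨_, .single (.boxArg _ _ _ _ _ _ h₂), .single (.boxBody _ _ _ h₁)⟩
    | boxBody _ _ K h₂ =>
      cases hM with
      | box _ _ _ _ hM hB =>
        obtain ⟨L, hL, hL'⟩ := ih h₂ hM
        exact ⟨.box B L, hL.boxBody B, lift (.box B) (fun _ _ => .boxBody _ _ _) hL'⟩

-- From commutation to confluence.

/-- Two relations commute on an invariant set, if they do so locally in the strong sense. -/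
theorem commute_of_strong {α : Type*} {r s : α → α → Prop} {T : α → Prop}
    (hr : ∀ {a b}, T a → r a b → T b) (hs : ∀ {a b}, T a → s a b → T b)
    (h : ∀ {a b c}, T a → r a b → s a c → ∃ d, ReflTransGen s b d ∧ ReflGen r c d)
    {a b c : α} (ha : T a) (hab : ReflTransGen r a b) (hac : ReflTransGen s a c) :
    ∃ d, ReflTransGen s b d ∧ ReflTransGen r c d := by
  have invariant : ∀ {t : α → α → Prop}, (∀ {a b}, T a → t a b → T b) →
      ∀ {a b}, T a → ReflTransGen t a b → T b := by
    intro t ht a b ha h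
    induction h with
    | refl => exact ha
    | tail _ h ih => exact ht ih h
  -- Along any `s`-reduction an `r`-step survives as at most one `r`-step, so the squares can be
  -- pasted.
  have strip : ∀ {a b c}, T a → r a b → ReflTransGen s a c →
      ∃ d, ReflTransGen s b d ∧ ReflGen r c d := by
    intro a b c ha hab hac
    induction hac with
    | refl => exact ⟨b, .refl, .single hab⟩
    | tail h₁ h₂ ih =>
      obtain ⟨d, hd, hd'⟩ := ih
      cases hd' with
      | refl => exact ⟨_, hd.tail h₂, .refl⟩
      | single hd' =>
        obtain ⟨e, he, he'⟩ := h (invariant hs ha h₁) hd' h₂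
        exact ⟨e, hd.trans he, he'⟩
  induction hab with
  | refl => exact ⟨c, hac, .refl⟩
  | tail h₁ h₂ ih =>
    obtain ⟨d, hd, hd'⟩ := ih
    obtain ⟨e, he, he'⟩ := strip (invariant hr ha h₁) h₂ hd
    exact ⟨e, he, hd'.trans he'.to_reflTransGen⟩

theorem Steps.commute {X : Set Label} {Γ : List (Ty P)} {τ : Ty P} {M N₁ N₂ : Tm P C}
    (hM : Typing Γ M τ) (h₁ : Steps X M N₁) (h₂ : Steps etaId M N₂) :
    ∃ L, Steps etaId N₁ L ∧ Steps X N₂ L :=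
  commute_of_strong (T := fun M => Typing Γ M τ) (fun hM h => h.typing hM)
    (fun hM h => h.typing hM) (fun hM h₁ h₂ => h₁.commute h₂ hM) hM h₁ h₂

theorem beta_subset_cbn : beta ⊆ cbn := by
  rintro _ (rfl | rfl) <;> simp [cbn]

theorem etaId_subset_cbn : etaId ⊆ cbn := by
  rintro _ (rfl | rfl) <;> simp [cbn]

theorem Step.beta_or_etaId {M N : Tm P C} (h : Step cbn M N) : Step beta M N ∨ Step etaId M N := by
  induction h with
  | rule l hl M N h =>
    rcases hl with rfl | rfl | rfl | rfl
    · exact .inl (.rule _ (by simp [beta]) _ _ h)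
    · exact .inr (.rule _ (by simp [etaId]) _ _ h)
    · exact .inr (.rule _ (by simp [etaId]) _ _ h)
    · exact .inl (.rule _ (by simp [beta]) _ _ h)
  | lam σ M M' _ ih => exact ih.imp (.lam _ _ _) (.lam _ _ _)
  | appLeft M M' N _ ih => exact ih.imp (.appLeft _ _ _) (.appLeft _ _ _)
  | appRight M N N' _ ih => exact ih.imp (.appRight _ _ _) (.appRight _ _ _)
  | boxArg B₁ B₂ σ N N' M _ ih => exact ih.imp (.boxArg _ _ _ _ _ _) (.boxArg _ _ _ _ _ _)
  | boxBody B M M' _ ih => exact ih.imp (.boxBody _ _ _) (.boxBody _ _ _)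

theorem cbn_confluent {Γ : List (Ty P)} {τ : Ty P} {M N₁ N₂ : Tm P C} (hM : Typing Γ M τ)
    (h₁ : Steps cbn M N₁) (h₂ : Steps cbn M N₂) : ∃ L, Steps cbn N₁ L ∧ Steps cbn N₂ L := by
  -- Typability is built into the relation because `church_rosser` asks for the diamond at every
  -- term. Using many-step halves makes one step on each side suffice.
  let r : Tm P C → Tm P C → Prop := fun A B => Typing Γ A τ ∧ (Steps beta A B ∨ Steps etaId A B)
  have to_r : ∀ {N}, Steps cbn M N → ReflTransGen r M N := by
    intro N h
    induction h with
    | refl => exact .refl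
    | tail h h' ih =>
      exact ih.tail ⟨Steps.typing h hM, h'.beta_or_etaId.imp .single .single⟩
  have of_r : ∀ {A B}, ReflTransGen r A B → Steps cbn A B := by
    intro A B h
    induction h with
    | refl => exact .refl
    | tail _ h ih =>
      exact ih.trans (h.2.elim (Steps.mono beta_subset_cbn) (Steps.mono etaId_subset_cbn))
  obtain ⟨L, hL, hL'⟩ := church_rosser (r := r) (fun A B D ⟨hA, hB⟩ ⟨_, hD⟩ => by
    have tB : Typing Γ B τ := hB.elim (fun h => h.typing hA) fun h => h.typing hA
    have tD : Typing Γ D τ := hD.elim (fun h => h.typing hA) fun h => h.typing hA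
    rcases hB with hB | hB <;> rcases hD with hD | hD
    · obtain ⟨E, h, h'⟩ := beta_confluent hA.scoped hB hD
      exact ⟨E, .single ⟨tB, .inl h⟩, .single ⟨tD, .inl h'⟩⟩
    · obtain ⟨E, h, h'⟩ := Steps.commute hA hB hD
      exact ⟨E, .single ⟨tB, .inr h⟩, .single ⟨tD, .inl h'⟩⟩
    · obtain ⟨E, h, h'⟩ := Steps.commute hA hD hB
      exact ⟨E, .single ⟨tB, .inl h'⟩, .single ⟨tD, .inr h⟩⟩
    -- Commutation of `etaId` with itself is its confluence.
    · obtain ⟨E, h, h'⟩ := Steps.commute hA hB hD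
      exact ⟨E, .single ⟨tB, .inr h⟩, .single ⟨tD, .inr h'⟩⟩) (to_r h₁) (to_r h₂)
  exact ⟨L, of_r hL, of_r hL'⟩

end LamBox

theorem proposition3 {P : Type*} {C : Type*} (Γ : List (LamBox.Ty P)) (τ : LamBox.Ty P)
    (M N₁ N₂ : LamBox.Tm P C) (hM : LamBox.Typing Γ M τ)
    (h₁ : Relation.ReflTransGen (LamBox.Step LamBox.cbn) M N₁)
    (h₂ : Relation.ReflTransGen (LamBox.Step LamBox.cbn) M N₂) :
    ∃ L : LamBox.Tm P C, Relation.ReflTransGen (LamBox.Step LamBox.cbn) N₁ L ∧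
      Relation.ReflTransGen (LamBox.Step LamBox.cbn) N₂ L := by
  exact LamBox.cbn_confluent hM h₁ h₂
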